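/- Let $K$ be a real quadratic field with its two distinct real embeddings $\iota_1,\iota_2$; regard $K\subset\mathbb{R}$ through $\iota_1$ and write $x'=\iota_2(x)$. Let $\mathfrak{b}$ be an ideal of $\mathcal{O}_K$ with $\mathfrak{b}^{-1}=\mathbb{Z}\omega+\mathbb{Z}$, where $\omega=[[a_0,a_1,\dots,a_{r-1}]]$ has a purely periodic regular continued fraction of (minimal) period $r$, and put $a_{n+r}=a_n$. Let $\ell=r$ if $r$ is even and $\ell=2r$ if $r$ is odd. Let $\varepsilon>1$ be the totally positive fundamental unit of $K$ (the generator $>1$ of the group of totally positive units). Define $(\alpha_i,\beta_i)\in\mathbb{Z}^2$ by $$(\alpha_{-2},\beta_{-2})=(1,-a_0),\quad(\alpha_{-1},\beta_{-1})=(0,1),\quad(\alpha_i,\beta_i)=a_{\ell-i}(\alpha_{i-1},\beta_{i-1})+(\alpha_{i-2},\beta_{i-2})\ \ (0\le i\le\ell-1),$$ so $(\alpha_0,\beta_0)=(1,0)$. Put $$M_i(x_1,x_2)=(-1)^{i+1}\big((\beta_i\alpha_{\ell-1}-\alpha_i\beta_{\ell-1})x_2+\alpha_ix_1\big),\qquad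 R_k(X,Y)=\sum_{j=0}^{2k}X^{2k-j}Y^j,$$ $$Q(x_1,x_2)=N(\mathfrak{b})(x_1\omega+x_2)(x_1\omega'+x_2).$$ Let $\sigma$ be the cone generated by $(0,1)$ and $(\alpha_{\ell-1},\beta_{\ell-1})$ and, for $h=(h_1,h_2)\in\mathbb{R}^2$, let $$\sigma(h)=\{x\in\mathbb{R}^2:\ -\beta_{\ell-1}x_1+\alpha_{\ell-1}x_2\ge-h_1,\ x_1\ge-h_2\},\qquad I(h)=\int_{\sigma(h)}e^{-Q(x_1,x_2)}\,dx_1dx_2 .$$ For an integer $k\ge0$ put $$\mathcal{D}_k=-a_\ell R_k(M_{-2},M_0)(\partial_{h_1},\partial_{h_2})\,\alpha_{\ell-1}\partial_{h_1}\partial_{h_2}-\partial_{h_1}M_0(\partial_{h_1},\partial_{h_2})^{2k+1}+\partial_{h_2}M_{\ell-2}(\partial_{h_1},\partial_{h_2})^{2k+1},$$ $$\mathcal{R}=\frac{B_{2k+2}}{(2k+2)!}\,\mathcal{D}_k,$$ where $B_n$ denotes the Bernoulli numbers. Then, for every integer $k\ge 0$: 1. the integral $I(h)$ converges absolutely for every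 $h\in\mathbb{R}^2$ and $I$ is a $C^\infty$ function of $h$; 2. (vanishing) $\displaystyle \mathcal{R}\circ\int_{\sigma(h)}e^{-Q(x_1,x_2)}\,dx_1dx_2\Big|_{h=0}=0$; 3. $\varepsilon+\varepsilon'=a_0\alpha_{\ell-1}+\beta_{\ell-1}+\alpha_{\ell-2}$; 4. with $P(x_1,x_2)=\frac{N(\mathfrak{b})}{\alpha_{\ell-1}^2}\big(x_2^2+(\varepsilon+\varepsilon')x_1x_2+x_1^2\big)$, the integral on the right-hand side below converges absolutely and $$\mathcal{D}_k\circ I\,\Big|_{h=0}=\frac1{\alpha_{\ell-1}}\sum_{i=0}^{2k}(-1)^{i+1}\binom{2k+1}{i+1}\big((a_0\alpha_{\ell-1}+\beta_{\ell-1})^{i+1}+\alpha_{\ell-2}^{\,i+1}\big)\,\partial_{h_2}^{i}\partial_{h_1}^{2k-i}e^{-P(h)}\Big|_{h=0}+\frac{2}{\alpha_{\ell-1}}\int_0^\infty\partial_{x_1}^{2k+1}e^{-P(-x_1,x_2)}\Big|_{x_1=0}dx_2 .$$ -/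

import Mathlib

open scoped nonZeroDivisors

noncomputable section

/-! ### Purely periodic continued fractions and the lattice vectors attached to them -/

/-- `x = [[a 0, a 1, …, a (r-1)]]`: the regular continued fraction of the real number `x` has
partial quotients `a 0, a 1, a 2, …`, all positive, and this sequence is purely periodic with
(minimal) period `r ≥ 1`. -/
def IsPurelyPeriodicCF (x : ℝ) (a : ℕ → ℕ) (r : ℕ) : Prop :=
  ((GenContFract.of x).h = (a 0 : ℝ) ∧
    ∀ n, (GenContFract.of x).partDens.get? n = some (a (n + 1) : ℝ)) ∧
  (∀ n, 0 < a n) ∧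
  0 < r ∧ (∀ n, a (n + r) = a n) ∧
  ∀ s, 0 < s → (∀ n, a (n + s) = a n) → r ≤ s

/-- The even period: `r` if `r` is even and `2 r` if `r` is odd. -/
def evenPeriod (r : ℕ) : ℕ := if Even r then r else 2 * r

/-- The vectors `(α_i, β_i)`, with the index shifted by two (`cfVec a ℓ j = (α_{j-2}, β_{j-2})`):
`(α_{-2}, β_{-2}) = (1, -a_0)`, `(α_{-1}, β_{-1}) = (0, 1)` and
`(α_j, β_j) = a_{ℓ-j} (α_{j-1}, β_{j-1}) + (α_{j-2}, β_{j-2})`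
(in particular `(α_0, β_0) = (1, 0)`, as `a_ℓ = a_0`). -/
def cfVec (a : ℕ → ℕ) (l : ℕ) : ℕ → ℤ × ℤ
  | 0 => (1, -(a 0 : ℤ))
  | 1 => (0, 1)
  | j + 2 => (a (l - j) : ℤ) • cfVec a l (j + 1) + cfVec a l j

/-- `α_i` for `i ≥ -2`. -/
def cfAlpha (a : ℕ → ℕ) (l : ℕ) (i : ℤ) : ℤ := (cfVec a l (i + 2).toNat).1

/-- `β_i` for `i ≥ -2`. -/
def cfBeta (a : ℕ → ℕ) (l : ℕ) (i : ℤ) : ℤ := (cfVec a l (i + 2).toNat).2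

/-! ### The quadratic field -/

/-- `ε > 1` is the totally positive fundamental unit of the real quadratic field `K` with real
embeddings `ι₁, ι₂` (and `K` regarded as a subfield of `ℝ` through `ι₁`): it is totally positive
and generates the group of totally positive units. -/
def IsTotPosFundamentalUnit {K : Type*} [Field K] (ι₁ ι₂ : K →+* ℝ)
    (ε : (NumberField.RingOfIntegers K)ˣ) : Prop :=
  1 < ι₁ (ε : NumberField.RingOfIntegers K) ∧ 0 < ι₂ (ε : NumberField.RingOfIntegers K) ∧
  ∀ η : (NumberField.RingOfIntegers K)ˣ,
    0 < ι₁ (η : NumberField.RingOfIntegers K) → 0 < ι₂ (η : NumberField.RingOfIntegers K) →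
      ∃ n : ℤ, η = ε ^ n

/-- The quadratic form `Q(x₁, x₂) = N(𝔟) (x₁ ω + x₂) (x₁ ω' + x₂)`. -/
def normForm {K : Type*} [Field K] [NumberField K] (ι₁ ι₂ : K →+* ℝ)
    (b : Ideal (NumberField.RingOfIntegers K)) (ω : K) (x : ℝ × ℝ) : ℝ :=
  (Ideal.absNorm b : ℝ) * (x.1 * ι₁ ω + x.2) * (x.1 * ι₂ ω + x.2)

/-! ### The shifted cone and the integral -/

/-- `σ(h) = {x ∈ ℝ² | ⟨x, u₁⟩ ≥ -h₁, ⟨x, u₂⟩ ≥ -h₂}`, where `σ` is the cone generated by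
`v₁ = (0, 1)` and `v₂ = (α, β)` (with `α > 0`), and `u₁ = (-β, α)`, `u₂ = (1, 0)` are its primitive
inward normals: `⟨v₁, u₂⟩ = ⟨v₂, u₁⟩ = 0` and `⟨v₁, u₁⟩ = ⟨v₂, u₂⟩ = α > 0`. -/
def shiftedCone (α β : ℤ) (h : ℝ × ℝ) : Set (ℝ × ℝ) :=
  {x | -h.1 ≤ x.1 * (-(β : ℝ)) + x.2 * (α : ℝ) ∧ -h.2 ≤ x.1 * 1 + x.2 * 0}

/-- `h ↦ ∫_{σ(h)} e^{-Q(x₁, x₂)} dx₁ dx₂`. -/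
def coneIntegral (Q : ℝ × ℝ → ℝ) (α β : ℤ) (h : ℝ × ℝ) : ℝ :=
  ∫ x in shiftedCone α β h, Real.exp (-Q x)

/-! ### Constant coefficient differential operators in two variables -/

/-- `∂_{h₁}`. -/
def partialOne (f : ℝ × ℝ → ℝ) (h : ℝ × ℝ) : ℝ := deriv (fun t => f (t, h.2)) h.1

/-- `∂_{h₂}`. -/
def partialTwo (f : ℝ × ℝ → ℝ) (h : ℝ × ℝ) : ℝ := deriv (fun t => f (h.1, t)) h.2

/-- `p(∂_{h₁}, ∂_{h₂}) ∘ f` for a polynomial `p(x₁, x₂)`; the variable `x₁` is `X 0` and `x₂` is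
`X 1`. -/
def diffOp (p : MvPolynomial (Fin 2) ℝ) (f : ℝ × ℝ → ℝ) (h : ℝ × ℝ) : ℝ :=
  ∑ m ∈ p.support, p.coeff m * (partialOne^[m 0] (partialTwo^[m 1] f)) h

/-- `M_i(x₁, x₂) = (-1)^{i+1} ((β_i α_{ℓ-1} - α_i β_{ℓ-1}) x₂ + α_i x₁)`. -/
def cfLinForm (a : ℕ → ℕ) (l : ℕ) (i : ℤ) : MvPolynomial (Fin 2) ℝ :=
  MvPolynomial.C ((-1 : ℝ) ^ (i + 1)) *
    (MvPolynomial.C ((cfBeta a l i * cfAlpha a l (l - 1) -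
        cfAlpha a l i * cfBeta a l (l - 1) : ℤ) : ℝ) * MvPolynomial.X 1 +
      MvPolynomial.C (cfAlpha a l i : ℝ) * MvPolynomial.X 0)

/-- `R_k(X, Y) = X^{2k} + X^{2k-1} Y + ⋯ + Y^{2k}`. -/
def polyR (k : ℕ) (p q : MvPolynomial (Fin 2) ℝ) : MvPolynomial (Fin 2) ℝ :=
  ∑ j ∈ Finset.range (2 * k + 1), p ^ (2 * k - j) * q ^ j

/-- `-a_ℓ R_k(M_{-2}, M_0) α_{ℓ-1} x₁ x₂ - x₁ M_0^{2k+1} + x₂ M_{ℓ-2}^{2k+1}`. -/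
def boundaryPoly (a : ℕ → ℕ) (l k : ℕ) : MvPolynomial (Fin 2) ℝ :=
  -(MvPolynomial.C (a l : ℝ) * polyR k (cfLinForm a l (-2)) (cfLinForm a l 0) *
      MvPolynomial.C (cfAlpha a l (l - 1) : ℝ) * MvPolynomial.X 0 * MvPolynomial.X 1)
    - MvPolynomial.X 0 * cfLinForm a l 0 ^ (2 * k + 1)
    + MvPolynomial.X 1 * cfLinForm a l (l - 2) ^ (2 * k + 1)

/-- The symbol of the boundary operator: `𝓡 = B_{2k+2} / (2k+2)! ·
(-a_ℓ R_k(M_{-2}, M_0) α_{ℓ-1} x₁ x₂ - x₁ M_0^{2k+1} + x₂ M_{ℓ-2}^{2k+1})`. -/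
def boundarySymbol (a : ℕ → ℕ) (l k : ℕ) : MvPolynomial (Fin 2) ℝ :=
  MvPolynomial.C (((bernoulli (2 * k + 2) : ℚ) : ℝ) / ((2 * k + 2).factorial : ℝ)) *
    boundaryPoly a l k

/-- `P(x₁, x₂) = N / α² · (x₂² + T x₁ x₂ + x₁²)`. -/
def traceForm (N α T : ℝ) (x : ℝ × ℝ) : ℝ :=
  N / α ^ 2 * (x.2 ^ 2 + T * x.1 * x.2 + x.1 ^ 2)

end

/-! Write A = a₀α + β, γ = α_{ℓ-2}, T = ε + ε' and c = N(𝔟)/α². In the coordinates y₁ = ⟨x, u₁⟩, y₂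
= ⟨x, u₂⟩ = x₁ the cone becomes a quadrant, with Jacobian α. If ε = αω + β, then α(x₁ω + x₂) = y₁ +
εy₂, and εε' = 1 turns Q into c(y₂² + T y₁y₂ + y₁²). Hence I = F/α, with F a Gaussian integral over
a shifted quadrant (`coneIntegral_eq_quadrantIntegral`). It converges because T ≥ 0.

Fubini and the fundamental theorem of calculus give ∂₁F(u,v) = E(u,v) and ∂₂F(u,v) = E(v,u), where E
is `edgeIntegral`, an exponential in u² times a Gaussian tail at -(T/2)u - v. This yields smoothness
and ∂₁∂₂F = e^{-P}.

The factor R_k telescopes (`boundaryPoly_eq`), so the symbol is -x₁(-x₁ + Ax₂)^{2k+1} + x₂(-γx₁ +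
x₂)^{2k+1}. A power of a linear form is an iterated directional derivative, so vanishing at 0
compares E along (-t, At) with E along (t, -γt). Their exponential factors coincide and the tails
start at (T/2 - A)t and (γ - T/2)t, which are equal exactly because T = A + γ. The second evaluation
comes from the binomial theorem: mixed terms contain ∂₁∂₂F = e^{-P}, and the two pure powers give
the same edge integral by symmetry.

The arithmetic is ε = αω + β with trace A + γ (`fundamental_unit_eq`). With complete quotients w_n
and B_n = 1/(w₁⋯w_n), the recurrence gives (αω + β)B_ℓ = 1, and this element acts on ℤω + ℤ with
determinant 1 and trace A + γ, so it is a totally positive unit. It is fundamental because ε⁻¹ is a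
minimal vector of the lattice, hence some B_n (`exists_quotProd_eq_of_unit`). Its sign under ι₂
makes n even, periodicity gives ℓ ≤ n, and so αω + β ≤ ε. -/

/-! ### Constant coefficient differential operators. -/

theorem diffOp_eq_sum_of_subset (f : ℝ × ℝ → ℝ) (h : ℝ × ℝ) {p : MvPolynomial (Fin 2) ℝ}
    {s : Finset (Fin 2 →₀ ℕ)} (hs : p.support ⊆ s) :
    diffOp p f h = ∑ m ∈ s, p.coeff m * (partialOne^[m 0] (partialTwo^[m 1] f)) h :=
  Finset.sum_subset hs fun m _ hm => by
    rw [MvPolynomial.notMem_support_iff.mp hm, zero_mul]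

/-- `diffOp` at a point, as a linear functional of the symbol. -/
noncomputable def diffOpLin (f : ℝ × ℝ → ℝ) (h : ℝ × ℝ) : MvPolynomial (Fin 2) ℝ →ₗ[ℝ] ℝ where
  toFun p := diffOp p f h
  map_add' p q := by
    classical
    rw [diffOp_eq_sum_of_subset f h (MvPolynomial.support_add (p := p) (q := q)),
      diffOp_eq_sum_of_subset f h (Finset.subset_union_left (s₁ := p.support) (s₂ := q.support)),
      diffOp_eq_sum_of_subset f h (Finset.subset_union_right (s₁ := p.support) (s₂ := q.support)),
      ← Finset.sum_add_distrib]
    simp only [MvPolynomial.coeff_add, add_mul]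
  map_smul' c p := by
    rw [diffOp_eq_sum_of_subset f h (MvPolynomial.support_smul (a := c) (f := p)), diffOp]
    simp only [MvPolynomial.coeff_smul, smul_eq_mul, mul_assoc, RingHom.id_apply, Finset.mul_sum]

theorem diffOpLin_apply (f : ℝ × ℝ → ℝ) (h : ℝ × ℝ) (p : MvPolynomial (Fin 2) ℝ) :
    diffOpLin f h p = diffOp p f h := rfl

theorem diffOp_C_mul (f : ℝ × ℝ → ℝ) (h : ℝ × ℝ) (c : ℝ) (p : MvPolynomial (Fin 2) ℝ) :
    diffOp (MvPolynomial.C c * p) f h = c * diffOp p f h := by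
  rw [← MvPolynomial.smul_eq_C_mul]
  exact (diffOpLin f h).map_smul c p

theorem diffOp_add (f : ℝ × ℝ → ℝ) (h : ℝ × ℝ) (p q : MvPolynomial (Fin 2) ℝ) :
    diffOp (p + q) f h = diffOp p f h + diffOp q f h := (diffOpLin f h).map_add p q

theorem diffOp_monomial (f : ℝ × ℝ → ℝ) (h : ℝ × ℝ) (m : Fin 2 →₀ ℕ) (c : ℝ) :
    diffOp (MvPolynomial.monomial m c) f h
      = c * (partialOne^[m 0] (partialTwo^[m 1] f)) h := by
  rw [diffOp_eq_sum_of_subset f h MvPolynomial.support_monomial_subset, Finset.sum_singleton,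
    MvPolynomial.coeff_monomial, if_pos rfl]

theorem diffOp_X_pow_mul_X_pow (f : ℝ × ℝ → ℝ) (h : ℝ × ℝ) (p q : ℕ) :
    diffOp (MvPolynomial.X 0 ^ p * MvPolynomial.X 1 ^ q) f h
      = (partialOne^[p] (partialTwo^[q] f)) h := by
  rw [MvPolynomial.X_pow_eq_monomial, MvPolynomial.X_pow_eq_monomial, MvPolynomial.monomial_mul,
    diffOp_monomial]
  simp

theorem partialOne_eq_fderiv {f : ℝ × ℝ → ℝ} (hf : Differentiable ℝ f) :
    partialOne f = fun h => fderiv ℝ f h (1, 0) := by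
  funext h
  have h1 : HasDerivAt (fun t : ℝ => (t, h.2)) ((1 : ℝ), (0 : ℝ)) h.1 :=
    (hasDerivAt_id _).prodMk (hasDerivAt_const _ _)
  exact (HasFDerivAt.comp_hasDerivAt (f := fun t : ℝ => (t, h.2)) h.1
    (hf (h.1, h.2)).hasFDerivAt h1).deriv

theorem partialTwo_eq_fderiv {f : ℝ × ℝ → ℝ} (hf : Differentiable ℝ f) :
    partialTwo f = fun h => fderiv ℝ f h (0, 1) := by
  funext h
  have h1 : HasDerivAt (fun t : ℝ => (h.1, t)) ((0 : ℝ), (1 : ℝ)) h.2 :=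
    (hasDerivAt_const _ _).prodMk (hasDerivAt_id _)
  exact (HasFDerivAt.comp_hasDerivAt (f := fun t : ℝ => (h.1, t)) h.2
    (hf (h.1, h.2)).hasFDerivAt h1).deriv

open scoped ContDiff in
theorem ContDiff.partialOne {f : ℝ × ℝ → ℝ} (hf : ContDiff ℝ ∞ f) :
    ContDiff ℝ ∞ (partialOne f) := by
  rw [partialOne_eq_fderiv (hf.differentiable (by simp))]
  exact (hf.fderiv_right (m := ∞) (by simp)).clm_apply contDiff_const

open scoped ContDiff in
theorem ContDiff.partialTwo {f : ℝ × ℝ → ℝ} (hf : ContDiff ℝ ∞ f) :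
    ContDiff ℝ ∞ (partialTwo f) := by
  rw [partialTwo_eq_fderiv (hf.differentiable (by simp))]
  exact (hf.fderiv_right (m := ∞) (by simp)).clm_apply contDiff_const

open scoped ContDiff in
theorem partialOne_partialTwo_comm {f : ℝ × ℝ → ℝ} (hf : ContDiff ℝ ∞ f) :
    partialOne (partialTwo f) = partialTwo (partialOne f) := by
  have hd : Differentiable ℝ (fderiv ℝ f) :=
    (hf.fderiv_right (m := ∞) (by simp)).differentiable (by simp)
  rw [partialOne_eq_fderiv (hf.partialTwo.differentiable (by simp)),
    partialTwo_eq_fderiv (hf.partialOne.differentiable (by simp)),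
    partialOne_eq_fderiv (hf.differentiable (by simp)),
    partialTwo_eq_fderiv (hf.differentiable (by simp))]
  funext h
  have key : ∀ v w, fderiv ℝ (fun h => fderiv ℝ f h v) h w = fderiv ℝ (fderiv ℝ f) h w v := by
    intro v w
    rw [fderiv_clm_apply (hd h) (differentiableAt_const v)]
    simp
  rw [key, key]
  exact (hf.contDiffAt (x := h)).isSymmSndFDerivAt
    (by simpa using! (WithTop.coe_le_coe.2 le_top : ((2 : ℕ∞) : ℕ∞ω) ≤ ∞)) (1, 0) (0, 1)

open scoped ContDiff in
theorem partialOne_iterate_partialTwo_comm {f : ℝ × ℝ → ℝ} (hf : ContDiff ℝ ∞ f) (n : ℕ) :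
    partialOne (partialTwo^[n] f) = partialTwo^[n] (partialOne f) := by
  induction n generalizing f with
  | zero => rfl
  | succ n ih =>
    rw [Function.iterate_succ_apply, ih hf.partialTwo, partialOne_partialTwo_comm hf,
      ← Function.iterate_succ_apply]

open scoped ContDiff in
theorem iterate_partialOne_iterate_partialTwo_comm {f : ℝ × ℝ → ℝ} (hf : ContDiff ℝ ∞ f)
    (m n : ℕ) : partialOne^[m] (partialTwo^[n] f) = partialTwo^[n] (partialOne^[m] f) := by
  induction m generalizing f with
  | zero => rfl
  | succ m ih =>
    rw [Function.iterate_succ_apply, partialOne_iterate_partialTwo_comm hf, ih hf.partialOne,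
      ← Function.iterate_succ_apply]

/-- For symmetric functions this exchanges the orders of differentiation in the two variables. -/
theorem iterate_partial_comp_swap (f : ℝ × ℝ → ℝ) (m n : ℕ) :
    partialTwo^[n] (partialOne^[m] (fun h => f h.swap))
      = fun h => (partialOne^[n] (partialTwo^[m] f)) h.swap := by
  have h1 : ∀ (m : ℕ) (f : ℝ × ℝ → ℝ),
      partialOne^[m] (fun h => f h.swap) = fun h => (partialTwo^[m] f) h.swap := by
    intro m
    induction m with
    | zero => intro f; rfl
    | succ m ih => intro f; exact ih (partialTwo f)
  have h2 : ∀ (m : ℕ) (f : ℝ × ℝ → ℝ),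
      partialTwo^[m] (fun h => f h.swap) = fun h => (partialOne^[m] f) h.swap := by
    intro m
    induction m with
    | zero => intro f; rfl
    | succ m ih => intro f; exact ih (partialOne f)
  rw [h1, h2]

/-- No smoothness is needed here, because `diffOp` applies the second partial derivatives first; the
analogue for `X 0` has to commute partials. -/
theorem diffOp_X_one_mul (f : ℝ × ℝ → ℝ) (h : ℝ × ℝ) (p : MvPolynomial (Fin 2) ℝ) :
    diffOp (MvPolynomial.X 1 * p) f h = diffOp p (partialTwo f) h := by
  induction p using MvPolynomial.induction_on' with
  | monomial m c =>
    rw [MvPolynomial.X, MvPolynomial.monomial_mul, diffOp_monomial, diffOp_monomial]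
    simp [add_comm 1 (m 1)]
  | add p q hp hq => rw [mul_add, diffOp_add, hp, hq, diffOp_add]

open scoped ContDiff in
theorem diffOp_X_zero_mul {f : ℝ × ℝ → ℝ} (hf : ContDiff ℝ ∞ f) (h : ℝ × ℝ)
    (p : MvPolynomial (Fin 2) ℝ) :
    diffOp (MvPolynomial.X 0 * p) f h = diffOp p (partialOne f) h := by
  induction p using MvPolynomial.induction_on' with
  | monomial m c =>
    rw [MvPolynomial.X, MvPolynomial.monomial_mul, diffOp_monomial, diffOp_monomial]
    simp [add_comm 1 (m 0), partialOne_iterate_partialTwo_comm hf]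
  | add p q hp hq => rw [mul_add, diffOp_add, hp, hq, diffOp_add]

open scoped ContDiff in
/-- A power of a linear form acts as an iterated directional derivative. -/
theorem diffOp_linear_pow {f : ℝ × ℝ → ℝ} (hf : ContDiff ℝ ∞ f) (u v : ℝ) (n : ℕ) (h : ℝ × ℝ) :
    diffOp ((MvPolynomial.C u * MvPolynomial.X 0 + MvPolynomial.C v * MvPolynomial.X 1) ^ n) f h
      = iteratedDeriv n (fun t : ℝ => f (h.1 + t * u, h.2 + t * v)) 0 := by
  have hline : ContDiff ℝ ∞ (fun t : ℝ => ((h.1 + t * u, h.2 + t * v) : ℝ × ℝ)) := by fun_prop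
  induction n generalizing f with
  | zero =>
    have := diffOp_X_pow_mul_X_pow f h 0 0
    simpa using this
  | succ n ih =>
    rw [pow_succ', add_mul, diffOp_add, mul_assoc, mul_assoc, diffOp_C_mul, diffOp_C_mul,
      diffOp_X_zero_mul hf, diffOp_X_one_mul, ih hf.partialOne, ih hf.partialTwo,
      iteratedDeriv_succ']
    have hd : deriv (fun t : ℝ => f (h.1 + t * u, h.2 + t * v)) =
        fun t => u * partialOne f (h.1 + t * u, h.2 + t * v)
          + v * partialTwo f (h.1 + t * u, h.2 + t * v) := by
      funext t
      have h1 : HasDerivAt (fun t : ℝ => ((h.1 + t * u, h.2 + t * v) : ℝ × ℝ)) (u, v) t := by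
        have e1 := ((hasDerivAt_id t).mul_const u).const_add h.1
        have e2 := ((hasDerivAt_id t).mul_const v).const_add h.2
        simpa using e1.prodMk e2
      have hdf := hf.differentiable (by simp)
      rw [partialOne_eq_fderiv hdf, partialTwo_eq_fderiv hdf]
      have h2 := HasFDerivAt.comp_hasDerivAt (f := fun t : ℝ => (h.1 + t * u, h.2 + t * v)) t
        (hdf (h.1 + t * u, h.2 + t * v)).hasFDerivAt h1
      refine h2.deriv.trans ?_
      have h3 : ((u, v) : ℝ × ℝ) = u • (1, 0) + v • (0, 1) := by simp
      rw [h3, map_add, map_smul, map_smul]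
      rfl
    have c1 : ContDiff ℝ ∞ (fun t : ℝ => partialOne f (h.1 + t * u, h.2 + t * v)) :=
      hf.partialOne.comp hline
    have c2 : ContDiff ℝ ∞ (fun t : ℝ => partialTwo f (h.1 + t * u, h.2 + t * v)) :=
      hf.partialTwo.comp hline
    have le : ((n : ℕ∞ω)) ≤ ∞ := by exact_mod_cast le_top
    rw [hd, iteratedDeriv_fun_add (((contDiff_const.mul c1).of_le le).contDiffAt)
      (((contDiff_const.mul c2).of_le le).contDiffAt), iteratedDeriv_const_mul_field,
      iteratedDeriv_const_mul_field]

/-! ### Gaussian tails and edge integrals. -/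

open MeasureTheory in
theorem hasDerivAt_integral_Ioi {f : ℝ → ℝ} (hc : Continuous f)
    (hi : ∀ a, IntegrableOn f (Set.Ioi a)) (x : ℝ) :
    HasDerivAt (fun z => ∫ t in Set.Ioi z, f t) (-f x) x := by
  have h1 : (fun z => ∫ t in Set.Ioi z, f t)
      = fun z => (∫ t in Set.Ioi 0, f t) - ∫ t in (0 : ℝ)..z, f t := by
    funext z
    rw [← intervalIntegral.integral_Ioi_sub_Ioi' (hi 0) (hi z), sub_sub_cancel]
  rw [h1]
  exact (intervalIntegral.integral_hasDerivAt_right (hc.intervalIntegrable _ _)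
    hc.aestronglyMeasurable.stronglyMeasurableAtFilter hc.continuousAt).const_sub _

/-- The Gaussian tail `∫_z^∞ e^{-c t²} dt`. -/
noncomputable def gaussTail (c z : ℝ) : ℝ := ∫ t in Set.Ioi z, Real.exp (-c * t ^ 2)

theorem hasDerivAt_gaussTail {c : ℝ} (hc : 0 < c) (z : ℝ) :
    HasDerivAt (gaussTail c) (-Real.exp (-c * z ^ 2)) z :=
  hasDerivAt_integral_Ioi (by fun_prop) (fun _ => (integrable_exp_neg_mul_sq hc).integrableOn) z

open scoped ContDiff in
theorem contDiff_gaussTail {c : ℝ} (hc : 0 < c) : ContDiff ℝ ∞ (gaussTail c) := by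
  rw [contDiff_infty_iff_deriv]
  refine ⟨fun z => (hasDerivAt_gaussTail hc z).differentiableAt, ?_⟩
  rw [funext fun z => (hasDerivAt_gaussTail hc z).deriv]
  fun_prop

/-- The closed form of `∫_{-v}^∞ e^{-c (y² - T u y + u²)} dy`. -/
noncomputable def edgeIntegral (c T u v : ℝ) : ℝ :=
  Real.exp (c * (T ^ 2 / 4 - 1) * u ^ 2) * gaussTail c (-(T / 2) * u - v)

open scoped ContDiff in
theorem contDiff_edgeIntegral {c : ℝ} (hc : 0 < c) (T : ℝ) {E : Type*} [NormedAddCommGroup E]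
    [NormedSpace ℝ E] {f g : E → ℝ} (hf : ContDiff ℝ ∞ f) (hg : ContDiff ℝ ∞ g) :
    ContDiff ℝ ∞ (fun x => edgeIntegral c T (f x) (g x)) :=
  (Real.contDiff_exp.comp (contDiff_const.mul (hf.pow 2))).mul
    ((contDiff_gaussTail hc).comp ((contDiff_const.mul hf).sub hg))

theorem gauss_complete_square (c T u y : ℝ) :
    Real.exp (-(c * (y ^ 2 - T * u * y + u ^ 2)))
      = Real.exp (c * (T ^ 2 / 4 - 1) * u ^ 2) * Real.exp (-c * (y - T / 2 * u) ^ 2) := by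
  rw [← Real.exp_add]
  ring_nf

open MeasureTheory in
theorem integrable_exp_neg_quadratic {c : ℝ} (hc : 0 < c) (T u : ℝ) :
    Integrable (fun y : ℝ => Real.exp (-(c * (y ^ 2 - T * u * y + u ^ 2)))) := by
  simp only [gauss_complete_square]
  exact ((integrable_exp_neg_mul_sq hc).comp_sub_right (T / 2 * u)).const_mul _

open MeasureTheory in
theorem integral_exp_neg_quadratic (c T u v : ℝ) :
    ∫ y in Set.Ioi (-v), Real.exp (-(c * (y ^ 2 - T * u * y + u ^ 2))) = edgeIntegral c T u v := by
  simp only [gauss_complete_square]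
  rw [integral_const_mul, edgeIntegral, gaussTail]
  congr 1
  have h := (measurePreserving_sub_right (volume : Measure ℝ) (T / 2 * u)).setIntegral_preimage_emb
    (MeasurableEquiv.subRight (T / 2 * u)).measurableEmbedding
    (fun t => Real.exp (-c * t ^ 2)) (Set.Ioi (-(T / 2) * u - v))
  rw [← h]
  congr 2
  ext y
  simp only [Set.mem_Ioi, Set.mem_preimage]
  constructor <;> intro h <;> linarith

theorem hasDerivAt_edgeIntegral_right {c : ℝ} (hc : 0 < c) (T u v : ℝ) :
    HasDerivAt (fun v => edgeIntegral c T u v) (Real.exp (-(c * (v ^ 2 + T * u * v + u ^ 2)))) v := by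
  have h1 : HasDerivAt (fun v : ℝ => -(T / 2) * u - v) (-1) v := by
    simpa using (hasDerivAt_id v).const_sub (-(T / 2) * u)
  have h2 := ((hasDerivAt_gaussTail hc (-(T / 2) * u - v)).comp v h1).const_mul
    (Real.exp (c * (T ^ 2 / 4 - 1) * u ^ 2))
  refine h2.congr_deriv ?_
  have h3 := gauss_complete_square c T u (-v)
  rw [show -(c * (v ^ 2 + T * u * v + u ^ 2)) = -(c * ((-v) ^ 2 - T * u * (-v) + u ^ 2)) by ring,
    h3, show -v - T / 2 * u = -(T / 2) * u - v by ring]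
  ring

/-! ### The Gaussian integral over a shifted quadrant. -/

/-- The form may be indefinite, but the cross term hurts only when x and y have opposite signs. Then
the negative one is at least -H, so the cross term is bounded below by a linear term, which half of
the squares absorbs up to a constant. -/
theorem quadratic_lower_bound {T H x y : ℝ} (hT : 0 ≤ T) (hx : -H ≤ x)
    (hy : -H ≤ y) :
    (x ^ 2 + y ^ 2) / 2 - T ^ 2 * H ^ 2 ≤ y ^ 2 + T * x * y + x ^ 2 := by
  rcases le_total 0 (x * y) with h | h
  · nlinarith [mul_nonneg hT h, sq_nonneg x, sq_nonneg y, sq_nonneg (T * H)]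
  · have hb : -(H * x) ≤ x * y ∨ -(H * y) ≤ x * y := by
      rcases le_or_gt 0 x with h0 | h0
      · left; nlinarith
      · right
        have : 0 ≤ y := by
          by_contra! h1
          nlinarith
        nlinarith
    rcases hb with hb | hb
    · nlinarith [mul_le_mul_of_nonneg_left hb hT, sq_nonneg (x - T * H), sq_nonneg y,
        sq_nonneg (T * H)]
    · nlinarith [mul_le_mul_of_nonneg_left hb hT, sq_nonneg (y - T * H), sq_nonneg x,
        sq_nonneg (T * H)]

open MeasureTheory in
theorem integrableOn_quadrant {c T : ℝ} (hc : 0 < c) (hT : 0 ≤ T) (a b : ℝ) :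
    IntegrableOn (fun x : ℝ × ℝ => Real.exp (-(c * (x.2 ^ 2 + T * x.1 * x.2 + x.1 ^ 2))))
      (Set.Ici a ×ˢ Set.Ici b) := by
  set H := |a| + |b|
  have hg := ((integrable_exp_neg_mul_sq (half_pos hc)).mul_prod
    (integrable_exp_neg_mul_sq (half_pos hc))).const_mul (Real.exp (c * (T ^ 2 * H ^ 2)))
  refine Integrable.mono' hg.integrableOn (by fun_prop) ?_
  refine (ae_restrict_iff' (measurableSet_Ici.prod measurableSet_Ici)).2
    (Filter.Eventually.of_forall fun x hx => ?_)
  obtain ⟨h1, h2⟩ := hx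
  rw [Set.mem_Ici] at h1 h2
  have := quadratic_lower_bound (H := H) (x := x.1) (y := x.2) hT
    (by linarith [neg_abs_le a, abs_nonneg b]) (by linarith [neg_abs_le b, abs_nonneg a])
  rw [Real.norm_eq_abs, Real.abs_exp, ← Real.exp_add, ← Real.exp_add]
  apply Real.exp_le_exp.2
  nlinarith [mul_le_mul_of_nonneg_left this hc.le]

/-- The Gaussian integral over the shifted quadrant. -/
noncomputable def quadrantIntegral (c T : ℝ) (h : ℝ × ℝ) : ℝ :=
  ∫ x in Set.Ici (-h.1) ×ˢ Set.Ici (-h.2),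
    Real.exp (-(c * (x.2 ^ 2 + T * x.1 * x.2 + x.1 ^ 2)))

open MeasureTheory in
theorem quadrantIntegral_swap (c T : ℝ) (h : ℝ × ℝ) :
    quadrantIntegral c T h.swap = quadrantIntegral c T h := by
  have := setIntegral_prod_swap (μ := (volume : Measure ℝ)) (ν := (volume : Measure ℝ))
    (Set.Ici (-h.1)) (Set.Ici (-h.2))
    (fun x : ℝ × ℝ => Real.exp (-(c * (x.2 ^ 2 + T * x.1 * x.2 + x.1 ^ 2))))
  refine Eq.trans ?_ this
  simp only [quadrantIntegral, Prod.fst_swap, Prod.snd_swap]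
  congr 1
  funext x
  ring_nf

-- By Fubini the inner integral is an edge integral, so the first shift enters only through the
-- lower limit of the outer integral.
open MeasureTheory in
theorem hasDerivAt_quadrantIntegral_left {c T : ℝ} (hc : 0 < c) (hT : 0 ≤ T) (u v : ℝ) :
    HasDerivAt (fun t => quadrantIntegral c T (t, v)) (edgeIntegral c T u v) u := by
  have hinner : ∀ x : ℝ, (∫ y in Set.Ici (-v), Real.exp (-(c * (y ^ 2 + T * x * y + x ^ 2))))
      = edgeIntegral c T (-x) v := by
    intro x
    rw [integral_Ici_eq_integral_Ioi, ← integral_exp_neg_quadratic]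
    congr 1
    funext y
    ring_nf
  have hint : ∀ a, IntegrableOn (fun x => edgeIntegral c T (-x) v) (Set.Ioi a) := by
    intro a
    have h1 := integrableOn_quadrant hc hT a (-v)
    rw [IntegrableOn, Measure.volume_eq_prod, ← Measure.prod_restrict] at h1
    have h2 := h1.integral_prod_left
    simp only [hinner] at h2
    exact IntegrableOn.mono_set h2 Set.Ioi_subset_Ici_self
  have hfun : (fun t => quadrantIntegral c T (t, v))
      = fun t => (fun z => ∫ x in Set.Ioi z, edgeIntegral c T (-x) v) (-t) := by
    funext t
    rw [quadrantIntegral, Measure.volume_eq_prod, setIntegral_prod]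
    · simp only [hinner]
      rw [integral_Ici_eq_integral_Ioi]
    · exact integrableOn_quadrant hc hT (-t) (-v)
  have hcont : Continuous (fun x => edgeIntegral c T (-x) v) :=
    (contDiff_edgeIntegral hc T contDiff_neg contDiff_const).continuous
  rw [hfun]
  have h3 := (hasDerivAt_integral_Ioi hcont hint (-u)).comp u (hasDerivAt_neg u)
  refine h3.congr_deriv ?_
  simp

theorem hasDerivAt_quadrantIntegral_right {c T : ℝ} (hc : 0 < c) (hT : 0 ≤ T) (u v : ℝ) :
    HasDerivAt (fun t => quadrantIntegral c T (u, t)) (edgeIntegral c T v u) v := by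
  have := hasDerivAt_quadrantIntegral_left hc hT v u
  refine this.congr_of_eventuallyEq (Filter.Eventually.of_forall fun t => ?_)
  exact (quadrantIntegral_swap c T (u, t)).symm

open scoped ContDiff in
theorem contDiff_quadrantIntegral {c T : ℝ} (hc : 0 < c) (hT : 0 ≤ T) :
    ContDiff ℝ ∞ (quadrantIntegral c T) := by
  have c1 : ContDiff ℝ ∞ (fun h : ℝ × ℝ => edgeIntegral c T h.1 h.2) :=
    contDiff_edgeIntegral hc T contDiff_fst contDiff_snd
  have c2 : ContDiff ℝ ∞ (fun h : ℝ × ℝ => edgeIntegral c T h.2 h.1) :=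
    contDiff_edgeIntegral hc T contDiff_snd contDiff_fst
  have hd : ∀ h : ℝ × ℝ, HasFDerivAt (quadrantIntegral c T)
      ((edgeIntegral c T h.1 h.2) • ContinuousLinearMap.fst ℝ ℝ ℝ
        + (edgeIntegral c T h.2 h.1) • ContinuousLinearMap.snd ℝ ℝ ℝ) h := by
    intro h
    have := (hasStrictFDerivAt_uncurry_coprod (𝕜 := ℝ) (u := h)
      (f := fun u v => quadrantIntegral c T (u, v))
      (f₁ := fun u v => ContinuousLinearMap.toSpanSingleton ℝ (edgeIntegral c T u v))
      (f₂ := fun u v => ContinuousLinearMap.toSpanSingleton ℝ (edgeIntegral c T v u))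
      (Filter.Eventually.of_forall fun w =>
        (hasDerivAt_quadrantIntegral_left hc hT w.1 w.2).hasFDerivAt)
      (Filter.Eventually.of_forall fun w =>
        (hasDerivAt_quadrantIntegral_right hc hT w.1 w.2).hasFDerivAt)
      ((ContinuousLinearMap.toSpanSingletonCLE (𝕜 := ℝ) (E := ℝ)).continuous.comp
        c1.continuous).continuousAt
      ((ContinuousLinearMap.toSpanSingletonCLE (𝕜 := ℝ) (E := ℝ)).continuous.comp
        c2.continuous).continuousAt).hasFDerivAt
    refine this.congr_fderiv ?_
    ext <;> simp [Function.HasUncurry.uncurry]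
  rw [contDiff_infty_iff_fderiv]
  refine ⟨fun h => (hd h).differentiableAt, ?_⟩
  rw [funext fun h => (hd h).fderiv]
  exact (c1.smul contDiff_const).add (c2.smul contDiff_const)

theorem partialOne_quadrantIntegral {c T : ℝ} (hc : 0 < c) (hT : 0 ≤ T) :
    partialOne (quadrantIntegral c T) = fun h => edgeIntegral c T h.1 h.2 :=
  funext fun h => (hasDerivAt_quadrantIntegral_left hc hT h.1 h.2).deriv

theorem partialTwo_quadrantIntegral {c T : ℝ} (hc : 0 < c) (hT : 0 ≤ T) :
    partialTwo (quadrantIntegral c T) = fun h => edgeIntegral c T h.2 h.1 :=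
  funext fun h => (hasDerivAt_quadrantIntegral_right hc hT h.1 h.2).deriv

open MeasureTheory ProbabilityTheory in
open scoped ContDiff in
/-- Differentiation under the integral sign along an edge of the quadrant. -/
theorem iteratedDeriv_edgeIntegral {c : ℝ} (hc : 0 < c) (T : ℝ) (n : ℕ) :
    IntegrableOn (fun y : ℝ =>
        iteratedDeriv n (fun u : ℝ => Real.exp (-(c * (y ^ 2 - T * u * y + u ^ 2)))) 0)
        (Set.Ioi 0) ∧
      iteratedDeriv n (fun u => edgeIntegral c T u 0) 0 = ∫ y in Set.Ioi (0 : ℝ),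
        iteratedDeriv n (fun u : ℝ => Real.exp (-(c * (y ^ 2 - T * u * y + u ^ 2)))) 0 := by
  -- With the weight e^{-cy²} on the half line, the edge integral is e^{-cu²} times the moment
  -- generating function of X(y) = cTy. This function is finite for every u, hence analytic, and its
  -- derivatives at 0 are the moments.
  set w : ℝ → ENNReal := fun y => ENNReal.ofReal (Real.exp (-c * y ^ 2)) with hw
  have hwm : Measurable w := by fun_prop
  have hwr : ∀ y, (w y).toReal = Real.exp (-c * y ^ 2) := fun y =>
    ENNReal.toReal_ofReal (Real.exp_pos _).le
  set μ : Measure ℝ := (volume.restrict (Set.Ioi (0 : ℝ))).withDensity w with hμ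
  have hwlt : ∀ᵐ y ∂(volume.restrict (Set.Ioi (0 : ℝ))), w y < ⊤ :=
    Filter.Eventually.of_forall fun y => ENNReal.ofReal_lt_top
  set X : ℝ → ℝ := fun y => c * T * y with hX
  have hsplit : ∀ u y : ℝ, Real.exp (-(c * (y ^ 2 - T * u * y + u ^ 2)))
      = Real.exp (-c * u ^ 2) * (Real.exp (u * X y) * Real.exp (-c * y ^ 2)) := by
    intro u y
    rw [← Real.exp_add, ← Real.exp_add]
    simp only [hX]
    ring_nf
  have hint : ∀ u, Integrable (fun y => Real.exp (u * X y)) μ := by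
    intro u
    rw [hμ, integrable_withDensity_iff hwm hwlt]
    simp only [hwr]
    have h1 := ((integrable_exp_neg_quadratic hc T u).const_mul
      (Real.exp (-c * u ^ 2))⁻¹).integrableOn (s := Set.Ioi 0)
    simp only [hsplit, inv_mul_cancel_left₀ (Real.exp_pos _).ne'] at h1
    exact h1
  have hset : interior (integrableExpSet X μ) = Set.univ := by
    rw [show integrableExpSet X μ = Set.univ from Set.eq_univ_of_forall hint, interior_univ]
  have hmem : ∀ u, u ∈ interior (integrableExpSet X μ) := fun u => hset ▸ Set.mem_univ u
  have hmom : ∀ m : ℕ, IntegrableOn (fun y => X y ^ m * Real.exp (-c * y ^ 2)) (Set.Ioi 0) := by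
    intro m
    have h1 := integrable_pow_of_mem_interior_integrableExpSet (hmem 0) m
    rw [hμ, integrable_withDensity_iff hwm hwlt] at h1
    simp only [hwr] at h1
    exact h1
  have hmgf : ∀ u, edgeIntegral c T u 0 = Real.exp (-c * u ^ 2) * mgf X μ u := by
    intro u
    rw [← integral_exp_neg_quadratic, neg_zero]
    simp only [hsplit]
    rw [integral_const_mul, mgf, hμ, integral_withDensity_eq_integral_toReal_smul hwm hwlt]
    simp only [hwr, smul_eq_mul, mul_comm]
  have hE : ContDiffAt ℝ n (fun u : ℝ => Real.exp (-c * u ^ 2)) 0 := by fun_prop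
  have hM : ContDiffAt ℝ n (mgf X μ) 0 := (analyticAt_mgf (hmem 0)).contDiffAt
  -- Leibniz's rule is applied both to the integrand and to the product containing the moment
  -- generating function; the two sums then agree term by term.
  have hpt : ∀ y, iteratedDeriv n
      (fun u : ℝ => Real.exp (-(c * (y ^ 2 - T * u * y + u ^ 2)))) 0
      = ∑ i ∈ Finset.range (n + 1), (n.choose i *
        iteratedDeriv i (fun u : ℝ => Real.exp (-c * u ^ 2)) 0)
          * (X y ^ (n - i) * Real.exp (-c * y ^ 2)) := by
    intro y
    have h1 : (fun u : ℝ => Real.exp (-(c * (y ^ 2 - T * u * y + u ^ 2))))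
        = fun u => Real.exp (-c * u ^ 2) * (Real.exp (X y * u) * Real.exp (-c * y ^ 2)) := by
      funext u
      rw [hsplit, mul_comm u]
    rw [h1, iteratedDeriv_fun_mul hE (by fun_prop)]
    refine Finset.sum_congr rfl fun i _ => ?_
    rw [iteratedDeriv_mul_const_field, iteratedDeriv_exp_const_mul]
    simp
  have hterm : ∀ i, IntegrableOn (fun y => (n.choose i *
        iteratedDeriv i (fun u : ℝ => Real.exp (-c * u ^ 2)) 0)
          * (X y ^ (n - i) * Real.exp (-c * y ^ 2))) (Set.Ioi 0) := fun i =>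
    (hmom (n - i)).const_mul _
  simp only [hpt]
  refine ⟨integrable_finsetSum _ fun i _ => hterm i, ?_⟩
  rw [integral_finsetSum _ fun i _ => hterm i, funext hmgf, iteratedDeriv_fun_mul hE hM]
  refine Finset.sum_congr rfl fun i _ => ?_
  rw [integral_const_mul, iteratedDeriv_mgf_zero (hmem 0), hμ,
    integral_withDensity_eq_integral_toReal_smul hwm hwlt]
  simp only [hwr, smul_eq_mul, Pi.pow_apply, mul_comm]

/-! ### From the cone to the quadrant. -/

theorem det_shear_swap (α β : ℝ) :
    LinearMap.det (((-β) • LinearMap.fst ℝ ℝ ℝ + α • LinearMap.snd ℝ ℝ ℝ).prod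
      ((1 : ℝ) • LinearMap.fst ℝ ℝ ℝ + (0 : ℝ) • LinearMap.snd ℝ ℝ ℝ)) = -α := by
  rw [← Matrix.toLin_finTwoProd, LinearMap.det_toLin, Matrix.det_fin_two_of]
  ring

open MeasureTheory in
/-- In the coordinates given by the inward normals of the cone, the cone integral becomes an
integral over a shifted quadrant. -/
theorem coneIntegral_eq_quadrantIntegral {Q : ℝ × ℝ → ℝ} {α β : ℤ} (hα : 0 < α) {c T : ℝ}
    (hc : 0 < c) (hT : 0 ≤ T)
    (hQ : ∀ x : ℝ × ℝ, Q x = c * (x.1 ^ 2 + T * (x.1 * -β + x.2 * α) * x.1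
      + (x.1 * -β + x.2 * α) ^ 2)) (h : ℝ × ℝ) :
    IntegrableOn (fun x => Real.exp (-Q x)) (shiftedCone α β h) ∧
      coneIntegral Q α β h = 1 / (α : ℝ) * quadrantIntegral c T h := by
  have hα' : (0 : ℝ) < α := by exact_mod_cast hα
  set L : ℝ × ℝ →ₗ[ℝ] ℝ × ℝ := ((-(β : ℝ)) • LinearMap.fst ℝ ℝ ℝ
    + (α : ℝ) • LinearMap.snd ℝ ℝ ℝ).prod
      ((1 : ℝ) • LinearMap.fst ℝ ℝ ℝ + (0 : ℝ) • LinearMap.snd ℝ ℝ ℝ) with hL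
  have hLx : ∀ x : ℝ × ℝ, L x = (x.1 * -β + x.2 * α, x.1) := by
    intro x
    simp [hL, mul_comm]
  set L' : ℝ × ℝ →L[ℝ] ℝ × ℝ := L.toContinuousLinearMap with hL'
  have hdet : |L'.det| = α := by
    have : L'.det = -α := det_shear_swap α β
    rw [this, abs_neg, abs_of_pos hα']
  have hinj : Function.Injective L := by
    intro x y hxy
    rw [hLx, hLx, Prod.mk.injEq] at hxy
    obtain ⟨h1, h2⟩ := hxy
    rw [h2] at h1
    exact Prod.ext h2 (mul_right_cancel₀ hα'.ne' (add_left_cancel h1))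
  have hcont : Continuous L := L'.continuous
  have hpre : shiftedCone α β h = L ⁻¹' (Set.Ici (-h.1) ×ˢ Set.Ici (-h.2)) := by
    ext x
    simp [shiftedCone, hLx]
  have hmeas : MeasurableSet (shiftedCone α β h) := by
    rw [hpre]
    exact hcont.measurable (measurableSet_Ici.prod measurableSet_Ici)
  have hsurj : Function.Surjective L := LinearMap.injective_iff_surjective.1 hinj
  have himage : L '' shiftedCone α β h = Set.Ici (-h.1) ×ˢ Set.Ici (-h.2) := by
    rw [hpre, Set.image_preimage_eq _ hsurj]
  have hderiv : ∀ x ∈ shiftedCone α β h,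
      HasFDerivWithinAt L L' (shiftedCone α β h) x := fun x _ => L'.hasFDerivWithinAt
  have hg : ∀ x : ℝ × ℝ, Real.exp (-(c * ((L x).2 ^ 2 + T * (L x).1 * (L x).2 + (L x).1 ^ 2)))
      = Real.exp (-Q x) := by
    intro x
    rw [hLx, hQ]
  constructor
  · have h1 := (integrableOn_image_iff_integrableOn_abs_det_fderiv_smul volume hmeas hderiv
      hinj.injOn _).1 (himage ▸ integrableOn_quadrant hc hT (-h.1) (-h.2))
    simp only [hdet, hg, smul_eq_mul] at h1
    have h2 := h1.const_mul (α : ℝ)⁻¹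
    simp only [inv_mul_cancel_left₀ hα'.ne'] at h2
    exact h2
  · have h1 := integral_image_eq_integral_abs_det_fderiv_smul volume hmeas hderiv hinj.injOn
      (fun x : ℝ × ℝ => Real.exp (-(c * (x.2 ^ 2 + T * x.1 * x.2 + x.1 ^ 2))))
    rw [himage] at h1
    simp only [hdet, hg, smul_eq_mul] at h1
    rw [quadrantIntegral, h1, integral_const_mul, coneIntegral]
    field_simp

/-! ### The boundary operator on the quadrant integral. -/

/-- Smoothness is not required: over a field `deriv` commutes with a constant factor even at points
of non-differentiability. -/
theorem diffOp_const_mul (κ : ℝ) (f : ℝ × ℝ → ℝ) (h : ℝ × ℝ) (p : MvPolynomial (Fin 2) ℝ) :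
    diffOp p (fun x => κ * f x) h = κ * diffOp p f h := by
  have h1 : ∀ (m : ℕ) (f : ℝ × ℝ → ℝ),
      partialOne^[m] (fun x => κ * f x) = fun x => κ * (partialOne^[m] f) x := by
    intro m
    induction m with
    | zero => intro f; rfl
    | succ m ih =>
      intro f
      rw [Function.iterate_succ_apply, Function.iterate_succ_apply, ← ih]
      congr 1
      funext x
      exact deriv_const_mul_field κ
  have h2 : ∀ (m : ℕ) (f : ℝ × ℝ → ℝ),
      partialTwo^[m] (fun x => κ * f x) = fun x => κ * (partialTwo^[m] f) x := by
    intro m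
    induction m with
    | zero => intro f; rfl
    | succ m ih =>
      intro f
      rw [Function.iterate_succ_apply, Function.iterate_succ_apply, ← ih]
      congr 1
      funext x
      exact deriv_const_mul_field κ
  rw [diffOp, diffOp, Finset.mul_sum]
  refine Finset.sum_congr rfl fun m _ => ?_
  rw [h2, h1]
  ring

theorem diffOp_neg (f : ℝ × ℝ → ℝ) (h : ℝ × ℝ) (p : MvPolynomial (Fin 2) ℝ) :
    diffOp (-p) f h = -diffOp p f h := (diffOpLin f h).map_neg p

open MvPolynomial in
/-- The boundary operator annihilates the quadrant integral at the origin. -/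
theorem diffOp_boundary_quadrantIntegral {c T : ℝ} (hc : 0 < c) (hT : 0 ≤ T) {A γ : ℝ}
    (hA : T = A + γ) (n : ℕ) :
    diffOp (-(X 0 * (C (-1) * X 0 + C A * X 1) ^ n) + X 1 * (C (-γ) * X 0 + C 1 * X 1) ^ n)
      (quadrantIntegral c T) (0, 0) = 0 := by
  have hF := contDiff_quadrantIntegral hc hT
  rw [diffOp_add, diffOp_neg, diffOp_X_zero_mul hF, diffOp_X_one_mul,
    diffOp_linear_pow hF.partialOne, diffOp_linear_pow hF.partialTwo,
    partialOne_quadrantIntegral hc hT, partialTwo_quadrantIntegral hc hT, neg_add_eq_zero]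
  -- The two edge integrals already agree as functions of t, before any differentiation; T = A + γ
  -- matches the arguments of the tails.
  congr 1
  funext t
  simp only [edgeIntegral]
  congr 2
  · ring
  · rw [hA]
    ring

/-- The exponent is odd, so the first power is -(x - Ay)^{2k+1}. Splitting off the leading terms
leaves two pure powers, and every other term is divisible by xy, the symbol of the mixed derivative.
-/
theorem boundary_binomial {R : Type*} [CommRing R] (x y A γ : R) (k : ℕ) :
    -(x * (-1 * x + A * y) ^ (2 * k + 1)) + y * (-γ * x + 1 * y) ^ (2 * k + 1)
      = x * x ^ (2 * k + 1) + y * y ^ (2 * k + 1)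
        + ∑ i ∈ Finset.range (2 * k + 1), (-1) ^ (i + 1) * ((2 * k + 1).choose (i + 1) : R) *
          (A ^ (i + 1) * (x * (y * (x ^ (2 * k - i) * y ^ i)))
            + γ ^ (i + 1) * (x * (y * (x ^ i * y ^ (2 * k - i))))) := by
  have hodd : (-1 * x + A * y) ^ (2 * k + 1) = -((-1 * (A * y) + x) ^ (2 * k + 1)) := by
    rw [← Odd.neg_pow ⟨k, rfl⟩]
    ring
  have key : ∀ s u : R, (-1 * s + u) ^ (2 * k + 1) = u ^ (2 * k + 1)
      + ∑ i ∈ Finset.range (2 * k + 1), (-1) ^ (i + 1) * ((2 * k + 1).choose (i + 1) : R) *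
        (s ^ (i + 1) * u ^ (2 * k - i)) := by
    intro s u
    rw [add_pow, Finset.sum_range_succ', add_comm]
    congr 1
    · simp
    · refine Finset.sum_congr rfl fun i _ => ?_
      rw [mul_pow, show 2 * k + 1 - (i + 1) = 2 * k - i by omega]
      ring
  rw [hodd, key, show -γ * x + 1 * y = -1 * (γ * x) + y by ring, key, mul_neg, neg_neg, mul_add,
    mul_add, Finset.mul_sum, Finset.mul_sum, add_add_add_comm, ← Finset.sum_add_distrib]
  congr 1
  refine Finset.sum_congr rfl fun i _ => ?_
  rw [mul_pow, mul_pow]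
  ring

open MvPolynomial MeasureTheory in
open scoped ContDiff in
/-- Evaluation of the boundary operator on the quadrant integral. -/
theorem diffOp_boundary_quadrantIntegral_eq {c T : ℝ} (hc : 0 < c) (hT : 0 ≤ T) (A γ : ℝ)
    (k : ℕ) {P : ℝ × ℝ → ℝ} (hP : ∀ x, P x = c * (x.2 ^ 2 + T * x.1 * x.2 + x.1 ^ 2)) :
    IntegrableOn
      (fun x₂ : ℝ => iteratedDeriv (2 * k + 1) (fun x₁ : ℝ => Real.exp (-P (-x₁, x₂))) 0)
        (Set.Ioi 0) ∧
    diffOp (-(X 0 * (C (-1) * X 0 + C A * X 1) ^ (2 * k + 1))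
      + X 1 * (C (-γ) * X 0 + C 1 * X 1) ^ (2 * k + 1)) (quadrantIntegral c T) (0, 0)
      = (∑ i ∈ Finset.range (2 * k + 1), (-1 : ℝ) ^ (i + 1) * ((2 * k + 1).choose (i + 1) : ℝ) *
          (A ^ (i + 1) + γ ^ (i + 1)) *
            (partialTwo^[i] (partialOne^[2 * k - i] (fun h => Real.exp (-P h)))) (0, 0))
        + 2 * ∫ x₂ in Set.Ioi (0 : ℝ),
            iteratedDeriv (2 * k + 1) (fun x₁ : ℝ => Real.exp (-P (-x₁, x₂))) 0 := by
  have hF := contDiff_quadrantIntegral hc hT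
  have hedge : ∀ y u : ℝ, Real.exp (-P (-u, y)) = Real.exp (-(c * (y ^ 2 - T * u * y + u ^ 2))) := by
    intro y u
    rw [hP]
    ring_nf
  set g : ℝ × ℝ → ℝ := fun h => Real.exp (-P h) with hg
  have hgsmooth : ContDiff ℝ ∞ g := by
    simp only [hg, hP]
    fun_prop
  have hgswap : (fun h : ℝ × ℝ => g h.swap) = g := by
    funext h
    simp only [hg, hP, Prod.fst_swap, Prod.snd_swap]
    ring_nf
  have h12 : partialTwo (partialOne (quadrantIntegral c T)) = g := by
    rw [partialOne_quadrantIntegral hc hT]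
    funext h
    simp only [hg, hP]
    exact (hasDerivAt_edgeIntegral_right hc T h.1 h.2).deriv
  obtain ⟨hi, hd⟩ := iteratedDeriv_edgeIntegral hc T (2 * k + 1)
  simp only [← hedge] at hi hd
  refine ⟨hi, ?_⟩
  have hX0 : ∀ f : ℝ × ℝ → ℝ, diffOp (X 0 ^ (2 * k + 1)) f (0, 0)
      = (partialOne^[2 * k + 1] f) (0, 0) := by
    intro f
    simpa using diffOp_X_pow_mul_X_pow f (0, 0) (2 * k + 1) 0
  have e0 : diffOp (X 0 * X 0 ^ (2 * k + 1)) (quadrantIntegral c T) (0, 0)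
      = iteratedDeriv (2 * k + 1) (fun u => edgeIntegral c T u 0) 0 := by
    have := diffOp_linear_pow hF.partialOne 1 0 (2 * k + 1) (0, 0)
    rw [diffOp_X_zero_mul hF]
    simpa [partialOne_quadrantIntegral hc hT] using this
  have e1 : diffOp (X 1 * X 1 ^ (2 * k + 1)) (quadrantIntegral c T) (0, 0)
      = iteratedDeriv (2 * k + 1) (fun u => edgeIntegral c T u 0) 0 := by
    have := diffOp_linear_pow hF.partialTwo 0 1 (2 * k + 1) (0, 0)
    rw [diffOp_X_one_mul]
    simpa [partialTwo_quadrantIntegral hc hT] using this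
  have e2 : ∀ p q : ℕ, diffOp (X 0 * (X 1 * (X 0 ^ p * X 1 ^ q))) (quadrantIntegral c T) (0, 0)
      = (partialTwo^[q] (partialOne^[p] g)) (0, 0) := by
    intro p q
    rw [diffOp_X_zero_mul hF, diffOp_X_one_mul, h12, diffOp_X_pow_mul_X_pow,
      iterate_partialOne_iterate_partialTwo_comm hgsmooth]
  -- Symmetry of P lets the A-terms and the γ-terms share one derivative of e^{-P}.
  have e3 : ∀ p q : ℕ, (partialTwo^[q] (partialOne^[p] g)) (0, 0)
      = (partialTwo^[p] (partialOne^[q] g)) (0, 0) := by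
    intro p q
    have := iterate_partial_comp_swap g p q
    rw [hgswap, iterate_partialOne_iterate_partialTwo_comm hgsmooth] at this
    exact congrFun this (0, 0)
  have hbin := boundary_binomial (X 0 : MvPolynomial (Fin 2) ℝ) (X 1) (C A) (C γ) k
  simp only [C_neg, C_1]
  rw [hbin, diffOp_add, diffOp_add, e0, e1, ← diffOpLin_apply, map_sum, hd]
  have hsum : ∀ i ∈ Finset.range (2 * k + 1), diffOpLin (quadrantIntegral c T) (0, 0)
      ((-1) ^ (i + 1) * ((2 * k + 1).choose (i + 1) : MvPolynomial (Fin 2) ℝ) *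
        (C A ^ (i + 1) * (X 0 * (X 1 * (X 0 ^ (2 * k - i) * X 1 ^ i)))
          + C γ ^ (i + 1) * (X 0 * (X 1 * (X 0 ^ i * X 1 ^ (2 * k - i))))))
      = (-1 : ℝ) ^ (i + 1) * ((2 * k + 1).choose (i + 1) : ℝ) *
          (A ^ (i + 1) + γ ^ (i + 1)) * (partialTwo^[i] (partialOne^[2 * k - i] g)) (0, 0) := by
    intro i _
    have hcoef : ((-1) ^ (i + 1) * ((2 * k + 1).choose (i + 1) : MvPolynomial (Fin 2) ℝ))
        = C ((-1 : ℝ) ^ (i + 1) * ((2 * k + 1).choose (i + 1) : ℝ)) := by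
      simp
    rw [hcoef, ← C_pow, ← C_pow, diffOpLin_apply, diffOp_C_mul, diffOp_add, diffOp_C_mul,
      diffOp_C_mul, e2, e2, e3 i]
    ring
  rw [Finset.sum_congr rfl hsum]
  ring

/-! ### Telescoping of the boundary polynomial. -/

-- Since M_{-2} - M_0 = a_ℓ α x₂, the geometric sum R_k turns its term into -x₁(M_{-2}^{2k+1} -
-- M_0^{2k+1}), whose second half cancels the M_0 term. Evenness of ℓ and the determinant normalize
-- M_{ℓ-2} to -γx₁ + x₂.
open MvPolynomial in
theorem boundaryPoly_eq (a : ℕ → ℕ) (l k : ℕ) (hl : Even l) (hal : a l = a 0) {α β γ : ℤ}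
    (hα : α = cfAlpha a l (l - 1)) (hβ : β = cfBeta a l (l - 1)) (hγ : γ = cfAlpha a l (l - 2))
    (hdet : γ * β - α * cfBeta a l (l - 2) = 1) :
    boundaryPoly a l k = -(X 0 * (C (-1) * X 0 + C ((a 0 : ℝ) * α + β) * X 1) ^ (2 * k + 1))
      + X 1 * (C (-(γ : ℝ)) * X 0 + C 1 * X 1) ^ (2 * k + 1) := by
  have hm2 : cfLinForm a l (-2) = C (-1) * X 0 + C ((a 0 : ℝ) * α + β) * X 1 := by
    have h1 : cfAlpha a l (-2) = 1 := rfl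
    have h2 : cfBeta a l (-2) = -(a 0 : ℤ) := rfl
    have h3 : (-1 : ℝ) ^ ((-2 : ℤ) + 1) = -1 := by norm_num
    rw [cfLinForm, h1, h2, h3, ← hα, ← hβ]
    push_cast
    simp only [C_sub, C_mul, C_neg, C_add, C_1]
    ring
  have h0 : cfLinForm a l 0 = C (-1) * X 0 + C (β : ℝ) * X 1 := by
    have h1 : cfAlpha a l 0 = 1 := by
      simp [cfAlpha, cfVec]
    have h2 : cfBeta a l 0 = 0 := by
      simp [cfBeta, cfVec, hal]
    have h3 : (-1 : ℝ) ^ ((0 : ℤ) + 1) = -1 := by norm_num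
    rw [cfLinForm, h1, h2, h3, ← hα, ← hβ]
    push_cast
    simp only [C_sub, C_mul, C_neg, C_1, C_0]
    ring
  have hl2 : cfLinForm a l (l - 2) = C (-(γ : ℝ)) * X 0 + C 1 * X 1 := by
    have h3 : (-1 : ℝ) ^ ((l : ℤ) - 2 + 1) = -1 := by
      apply Odd.neg_one_zpow
      obtain ⟨m, hm⟩ := hl
      exact ⟨(m : ℤ) - 1, by omega⟩
    have h4 : cfBeta a l (l - 2) * α - γ * β = -1 := by linarith
    rw [cfLinForm, ← hγ, ← hα, ← hβ, h3, h4]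
    push_cast
    simp only [C_neg, C_1]
    ring
  have hR : polyR k (cfLinForm a l (-2)) (cfLinForm a l 0)
      * (cfLinForm a l (-2) - cfLinForm a l 0)
      = cfLinForm a l (-2) ^ (2 * k + 1) - cfLinForm a l 0 ^ (2 * k + 1) := by
    have h1 := geom_sum₂_mul (cfLinForm a l 0) (cfLinForm a l (-2)) (2 * k + 1)
    have h2 : polyR k (cfLinForm a l (-2)) (cfLinForm a l 0) = ∑ i ∈ Finset.range (2 * k + 1),
        cfLinForm a l 0 ^ i * cfLinForm a l (-2) ^ (2 * k + 1 - 1 - i) :=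
      Finset.sum_congr rfl fun i _ => mul_comm _ _
    rw [h2]
    linear_combination -h1
  have hdiff : cfLinForm a l (-2) - cfLinForm a l 0 = C (a l : ℝ) * C (α : ℝ) * X 1 := by
    rw [hm2, h0, hal]
    simp only [C_add, C_mul]
    ring
  rw [hdiff] at hR
  rw [boundaryPoly, ← hα, ← hm2, ← hl2]
  linear_combination (-(X 0 : MvPolynomial (Fin 2) ℝ)) * hR

/-! ### Complete quotients and reduced numbers. -/

/-- The complete quotients of `x` with respect to the partial quotients `a`. -/
def completeQuot {F : Type*} [Field F] (a : ℕ → ℕ) (x : F) : ℕ → F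
  | 0 => x
  | n + 1 => (completeQuot a x n - a n)⁻¹

theorem map_completeQuot {F G : Type*} [Field F] [Field G] (φ : F →+* G) (a : ℕ → ℕ) (x : F)
    (n : ℕ) : φ (completeQuot a x n) = completeQuot a (φ x) n := by
  induction n with
  | zero => rfl
  | succ n ih => simp [completeQuot, ih]

theorem completeQuot_succ' {F : Type*} [Field F] (a : ℕ → ℕ) (x : F) (n : ℕ) :
    completeQuot a x (n + 1) = completeQuot (fun m => a (m + 1)) (x - a 0)⁻¹ n := by
  induction n with
  | zero => rfl
  | succ n ih => rw [completeQuot, ih, completeQuot]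

/-- Since partial quotients exist at every index, the fractional part is nonzero: an integer would
give a terminating expansion. -/
theorem genContFract_shift {x : ℝ} {a : ℕ → ℕ} (h0 : (GenContFract.of x).h = (a 0 : ℝ))
    (h1 : ∀ n, (GenContFract.of x).partDens.get? n = some (a (n + 1) : ℝ)) :
    ((a 0 : ℝ) < x ∧ x < a 0 + 1) ∧ (GenContFract.of (x - a 0)⁻¹).h = (a 1 : ℝ) ∧
      ∀ n, (GenContFract.of (x - a 0)⁻¹).partDens.get? n = some (a (n + 2) : ℝ) := by
  rw [GenContFract.of_h_eq_floor] at h0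
  have hfr : Int.fract x = x - a 0 := by rw [← h0]; rfl
  have hne : Int.fract x ≠ 0 := by
    intro hz
    have hx : x = (⌊x⌋ : ℝ) := by
      have := Int.self_sub_floor x
      linarith
    have h2 := h1 0
    rw [hx, GenContFract.partDens, GenContFract.of_s_of_int] at h2
    simp at h2
  have hpos : 0 < x - a 0 := hfr ▸ lt_of_le_of_ne (Int.fract_nonneg x) (Ne.symm hne)
  have hlt : x - a 0 < 1 := hfr ▸ Int.fract_lt_one x
  refine ⟨⟨by linarith, by linarith⟩, ?_, fun n => ?_⟩
  · have h2 := h1 0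
    have h3 := GenContFract.of_s_head hne
    rw [GenContFract.partDens, Stream'.Seq.map_get?] at h2
    rw [Stream'.Seq.head] at h3
    rw [h3, hfr] at h2
    simpa [GenContFract.of_h_eq_floor] using h2
  · have h2 := h1 (n + 1)
    rw [GenContFract.partDens, Stream'.Seq.map_get?, GenContFract.of_s_succ, hfr] at h2
    rw [GenContFract.partDens, Stream'.Seq.map_get?]
    exact h2

theorem completeQuot_mem_Ioo {x : ℝ} {a : ℕ → ℕ} (h0 : (GenContFract.of x).h = (a 0 : ℝ))
    (h1 : ∀ n, (GenContFract.of x).partDens.get? n = some (a (n + 1) : ℝ)) (n : ℕ) :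
    (a n : ℝ) < completeQuot a x n ∧ completeQuot a x n < a n + 1 := by
  induction n generalizing x a with
  | zero => exact (genContFract_shift h0 h1).1
  | succ n ih =>
    rw [completeQuot_succ']
    exact ih (a := fun m => a (m + 1)) (genContFract_shift h0 h1).2.1
      (genContFract_shift h0 h1).2.2

/-- A sequence of complete quotients is determined by its integer parts. -/
theorem eq_of_same_partial_quotients {a : ℕ → ℕ} (ha : ∀ n, 0 < a n) {x y : ℕ → ℝ}
    (hx : ∀ n, (a n : ℝ) < x n ∧ x n < a n + 1) (hy : ∀ n, (a n : ℝ) < y n ∧ y n < a n + 1)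
    (hx' : ∀ n, x (n + 1) = (x n - a n)⁻¹) (hy' : ∀ n, y (n + 1) = (y n - a n)⁻¹) :
    x = y := by
  have ha' : ∀ n, (1 : ℝ) ≤ a n := fun n => by exact_mod_cast ha n
  have two : ∀ z : ℕ → ℝ, (∀ n, (a n : ℝ) < z n ∧ z n < a n + 1) →
      (∀ n, z (n + 1) = (z n - a n)⁻¹) → ∀ n, (z n - a n) * z (n + 1) = 1 ∧
        2 ≤ z n * z (n + 1) ∧ 0 < z n := by
    intro z hz hz' n
    have h1 : (z n - a n) * z (n + 1) = 1 := by
      rw [hz', mul_inv_cancel₀ (sub_pos.2 (hz n).1).ne']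
    have h2 : 1 < z (n + 1) := (ha' _).trans_lt (hz (n + 1)).1
    refine ⟨h1, ?_, by linarith [ha' n, (hz n).1]⟩
    nlinarith [ha' n]
  -- Inversion multiplies a difference by the product of the two new quotients. Consecutive
  -- quotients have product at least 2, so two steps expand by at least 4, whereas equal integer
  -- parts keep differences below 1.
  have step : ∀ n, 4 * |x n - y n| ≤ |x (n + 2) - y (n + 2)| := by
    intro n
    obtain ⟨p1, -, -⟩ := two x hx hx' n
    obtain ⟨p2, q2, r2⟩ := two x hx hx' (n + 1)
    obtain ⟨s1, -, -⟩ := two y hy hy' n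
    obtain ⟨s2, t2, u2⟩ := two y hy hy' (n + 1)
    have e1 : (x n - y n) * (x (n + 1) * y (n + 1)) = y (n + 1) - x (n + 1) := by
      linear_combination y (n + 1) * p1 - x (n + 1) * s1
    have e2 : (x (n + 1) - y (n + 1)) * (x (n + 2) * y (n + 2)) = y (n + 2) - x (n + 2) := by
      linear_combination y (n + 2) * p2 - x (n + 2) * s2
    have e3 : (x n - y n) * ((x (n + 1) * x (n + 2)) * (y (n + 1) * y (n + 2)))
        = x (n + 2) - y (n + 2) := by
      linear_combination (x (n + 2) * y (n + 2)) * e1 - e2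
    have e4 : 4 ≤ (x (n + 1) * x (n + 2)) * (y (n + 1) * y (n + 2)) := by nlinarith
    rw [← e3, abs_mul, abs_of_pos (by linarith : 0 < (x (n + 1) * x (n + 2)) * _)]
    nlinarith [abs_nonneg (x n - y n)]
  have iter : ∀ m n, 4 ^ m * |x n - y n| ≤ |x (n + 2 * m) - y (n + 2 * m)| := by
    intro m
    induction m with
    | zero => intro n; simp
    | succ m ih =>
      intro n
      have h1 := step (n + 2 * m)
      have h2 := ih n
      rw [show n + 2 * (m + 1) = n + 2 * m + 2 by ring]
      rw [pow_succ]
      linarith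
  funext n
  by_contra hne
  have hpos : 0 < |x n - y n| := abs_pos.2 (sub_ne_zero.2 hne)
  obtain ⟨m, hm⟩ := pow_unbounded_of_one_lt (1 / |x n - y n|) (by norm_num : (1 : ℝ) < 4)
  have h1 := iter m n
  have h2 : |x (n + 2 * m) - y (n + 2 * m)| < 1 := by
    rw [abs_lt]
    constructor <;> linarith [hx (n + 2 * m), hy (n + 2 * m)]
  rw [div_lt_iff₀ hpos] at hm
  linarith

/-- The conjugate complete quotients of a purely periodic continued fraction lie in `(-1, 0)`. -/
theorem conj_completeQuot_mem_Ioo {a : ℕ → ℕ} (ha : ∀ n, 0 < a n) {x y : ℕ → ℝ} {r : ℕ}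
    (hr : 0 < r) (hx : ∀ n, (a n : ℝ) < x n ∧ x n < a n + 1)
    (hx' : ∀ n, x (n + 1) = (x n - a n)⁻¹) (hy' : ∀ n, y (n + 1) = (y n - a n)⁻¹)
    (hper : ∀ n, y (n + r) = y n) (hne : x ≠ y) (hy0 : ∀ n, y n ≠ 0) (n : ℕ) :
    -1 < y n ∧ y n < 0 := by
  have ha' : ∀ n, (1 : ℝ) ≤ a n := fun n => by exact_mod_cast ha n
  -- If no conjugate were negative, the conjugates would have the same integer parts as the
  -- quotients themselves and thus equal them.
  have hneg : ∃ m, y m < 0 := by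
    by_contra! h
    have hpos : ∀ n, 0 < y n := fun n => lt_of_le_of_ne (h n) (hy0 n).symm
    have hlow : ∀ n, (a n : ℝ) < y n := fun n => by
      have := hpos (n + 1)
      rw [hy', inv_pos] at this
      linarith
    refine hne (eq_of_same_partial_quotients ha hx (fun n => ⟨hlow n, ?_⟩) hx' hy')
    have h1 : 1 < y (n + 1) := (ha' _).trans_lt (hlow _)
    rw [hy'] at h1
    have := (one_lt_inv₀ (sub_pos.2 (hlow n))).1 h1
    linarith
  -- The interval (-1, 0) traps the sequence after the first negative term; periodicity then carries
  -- the bound back to all indices.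
  have step : ∀ n, y n < 0 → -1 < y (n + 1) ∧ y (n + 1) < 0 := by
    intro n hn
    have h1 : 1 < -(y n - a n) := by linarith [ha' n]
    have h2 := inv_lt_one_of_one_lt₀ h1
    have h3 := inv_pos.2 (one_pos.trans h1)
    rw [inv_neg] at h2 h3
    rw [hy']
    constructor <;> linarith
  obtain ⟨m, hm⟩ := hneg
  have tail : ∀ j, -1 < y (m + 1 + j) ∧ y (m + 1 + j) < 0 := by
    intro j
    induction j with
    | zero => exact step m hm
    | succ j ih => exact step _ ih.2
  have hper' : ∀ k n, y (n + r * k) = y n := by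
    intro k
    induction k with
    | zero => intro n; rfl
    | succ k ih => intro n; rw [mul_add, mul_one, ← add_assoc, hper, ih]
  have hle : m + 1 ≤ n + r * (m + 1) := by nlinarith
  obtain ⟨j, hj⟩ := Nat.exists_eq_add_of_le hle
  rw [← hper' (m + 1) n, hj]
  exact tail j

/-! ### Periods and the vectors (α_i, β_i). -/

theorem minimal_period_dvd {a : ℕ → ℕ} {r n : ℕ} (hr : 0 < r) (hper : ∀ m, a (m + r) = a m)
    (hmin : ∀ s, 0 < s → (∀ m, a (m + s) = a m) → r ≤ s) (hn : ∀ m, a (m + n) = a m) :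
    r ∣ n := by
  by_contra h
  have hpos : 0 < n % r := Nat.pos_of_ne_zero fun h0 => h (Nat.dvd_of_mod_eq_zero h0)
  have hk : ∀ k m, a (m + r * k) = a m := by
    intro k
    induction k with
    | zero => intro m; rfl
    | succ k ih => intro m; rw [mul_add, mul_one, ← add_assoc, hper, ih]
  refine absurd (hmin (n % r) hpos fun m => ?_) (not_le.2 (Nat.mod_lt n hr))
  rw [← hk (n / r), add_assoc, Nat.mod_add_div, hn]

theorem evenPeriod_dvd {r n : ℕ} (hn : Even n) (h : r ∣ n) : evenPeriod r ∣ n := by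
  rw [evenPeriod]
  split_ifs with he
  · exact h
  · exact Nat.Coprime.mul_dvd_of_dvd_of_dvd
      (Nat.coprime_two_left.2 (Nat.not_even_iff_odd.1 he)) hn.two_dvd h

theorem even_evenPeriod (r : ℕ) : Even (evenPeriod r) := by
  rw [evenPeriod]
  split_ifs with he
  · exact he
  · exact even_two_mul r

theorem cfVec_det (a : ℕ → ℕ) (l j : ℕ) :
    (cfVec a l j).1 * (cfVec a l (j + 1)).2 - (cfVec a l (j + 1)).1 * (cfVec a l j).2
      = (-1) ^ j := by
  induction j with
  | zero => simp [cfVec]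
  | succ j ih =>
    rw [pow_succ, ← ih, cfVec]
    simp only [Prod.fst_add, Prod.snd_add, Prod.smul_fst, Prod.smul_snd, smul_eq_mul]
    ring

/-- The index starts at 1 because the initial vector has second entry -a₀; two consecutive vectors
are carried for the recurrence. -/
theorem cfVec_nonneg {a : ℕ → ℕ} {l : ℕ} (hal : a l = a 0) (j : ℕ) :
    0 ≤ (cfVec a l (j + 1)).1 ∧ 0 ≤ (cfVec a l (j + 1)).2 ∧
      0 ≤ (cfVec a l (j + 2)).1 ∧ 0 ≤ (cfVec a l (j + 2)).2 := by
  induction j with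
  | zero => simp [cfVec, hal]
  | succ j ih =>
    obtain ⟨h1, h2, h3, h4⟩ := ih
    refine ⟨h3, h4, ?_, ?_⟩
    · rw [cfVec]
      simp only [Prod.fst_add, Prod.smul_fst, smul_eq_mul]
      positivity
    · rw [cfVec]
      simp only [Prod.snd_add, Prod.smul_snd, smul_eq_mul]
      positivity

theorem cfVec_fst_pos {a : ℕ → ℕ} {l : ℕ} (hal : a l = a 0) (ha : ∀ n, 0 < a n) (j : ℕ) :
    0 < (cfVec a l (j + 2)).1 := by
  induction j with
  | zero => simp [cfVec]
  | succ j ih =>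
    rw [cfVec]
    simp only [Prod.fst_add, Prod.smul_fst, smul_eq_mul]
    have := mul_pos (by exact_mod_cast ha (l - (j + 1)) : (0 : ℤ) < a (l - (j + 1))) ih
    linarith [(cfVec_nonneg hal j).1]

/-! ### Products of inverse complete quotients. -/

/-- The products `1 / (w₁ ⋯ w_n)` of inverse complete quotients. -/
def quotProd {F : Type*} [Field F] (w : ℕ → F) : ℕ → F
  | 0 => 1
  | n + 1 => quotProd w n * (w (n + 1))⁻¹

section Quotients

variable {F : Type*} [Field F] {a : ℕ → ℕ} {w : ℕ → F}

theorem quotProd_succ (hw : ∀ n, w (n + 1) = (w n - a n)⁻¹) (n : ℕ) :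
    quotProd w (n + 1) = quotProd w n * (w n - a n) := by
  rw [quotProd, hw, inv_inv]

theorem quotProd_mul (h0 : ∀ n, w n ≠ 0) (n : ℕ) :
    quotProd w (n + 1) * w (n + 1) = quotProd w n := by
  rw [quotProd, inv_mul_cancel_right₀ (h0 _)]

theorem quotProd_recurrence (hw : ∀ n, w (n + 1) = (w n - a n)⁻¹) (h0 : ∀ n, w n ≠ 0) (n : ℕ) :
    quotProd w n = a (n + 1) * quotProd w (n + 1) + quotProd w (n + 2) := by
  rw [quotProd_succ hw (n + 1), ← quotProd_mul h0 n]
  ring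

/-- The vectors obey the recurrence of the B_n read backwards from n = ℓ + 1. The starting value (w₀
- a₀)B_ℓ = B_{ℓ+1} uses w_ℓ = w₀ and a_ℓ = a₀. -/
theorem cfVec_mul_quotProd (hw : ∀ n, w (n + 1) = (w n - a n)⁻¹) (h0 : ∀ n, w n ≠ 0) {l : ℕ}
    (hal : a l = a 0) (hwl : w l = w 0) (j : ℕ) (hj : j ≤ l) :
    (((cfVec a l j).1 : F) * w 0 + ((cfVec a l j).2 : F)) * quotProd w l
        = quotProd w (l + 1 - j) ∧
      (((cfVec a l (j + 1)).1 : F) * w 0 + ((cfVec a l (j + 1)).2 : F)) * quotProd w l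
        = quotProd w (l - j) := by
  induction j with
  | zero =>
    constructor
    · rw [Nat.sub_zero, quotProd_succ hw, hwl, hal]
      simp [cfVec]
      ring
    · simp [cfVec]
  | succ j ih =>
    obtain ⟨h1, h2⟩ := ih (by omega)
    refine ⟨by rw [h2]; congr 1; omega, ?_⟩
    obtain ⟨m, rfl⟩ : ∃ m, l = m + 1 + j := ⟨l - 1 - j, by omega⟩
    rw [show m + 1 + j + 1 - j = m + 2 by omega] at h1
    rw [show m + 1 + j - j = m + 1 by omega] at h2
    rw [show m + 1 + j - (j + 1) = m by omega, quotProd_recurrence hw h0 m, ← h1, ← h2, cfVec,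
      show m + 1 + j - j = m + 1 by omega]
    simp only [Prod.fst_add, Prod.snd_add, Prod.smul_fst, Prod.smul_snd, smul_eq_mul]
    push_cast
    ring

/-- Each step changes the pair (w_n B_n, B_n) by a unimodular matrix, so it stays a basis of ℤw₀ +
ℤ; the next lemma is the reverse inclusion. -/
theorem exists_quotProd_basis (hw : ∀ n, w (n + 1) = (w n - a n)⁻¹) (h0 : ∀ n, w n ≠ 0) (n : ℕ)
    (p q : ℤ) : ∃ p' q' : ℤ, (p : F) * w 0 + q = p' * (w n * quotProd w n) + q' * quotProd w n := by
  induction n with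
  | zero => exact ⟨p, q, by simp [quotProd]⟩
  | succ n ih =>
    obtain ⟨p', q', h⟩ := ih
    refine ⟨a n * p' + q', p', ?_⟩
    have h1 := quotProd_succ hw n
    have h2 := quotProd_mul h0 n
    rw [h, mul_comm (w (n + 1)), h2, h1]
    push_cast
    ring

theorem quotProd_basis_mem (hw : ∀ n, w (n + 1) = (w n - a n)⁻¹) (h0 : ∀ n, w n ≠ 0) (n : ℕ) :
    (∃ p q : ℤ, w n * quotProd w n = p * w 0 + q) ∧ ∃ p q : ℤ, quotProd w n = p * w 0 + q := by
  induction n with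
  | zero => exact ⟨⟨1, 0, by simp [quotProd]⟩, ⟨0, 1, by simp [quotProd]⟩⟩
  | succ n ih =>
    obtain ⟨⟨p, q, h⟩, ⟨p', q', h'⟩⟩ := ih
    refine ⟨⟨p', q', by rw [mul_comm, quotProd_mul h0, h']⟩, p - a n * p', q - a n * q', ?_⟩
    rw [quotProd_succ hw, mul_sub, mul_comm _ (w n), h, h']
    push_cast
    ring

end Quotients

section Real

variable {a : ℕ → ℕ} {x y : ℕ → ℝ}

theorem quotProd_pos (hx : ∀ n, 1 < x n) (n : ℕ) : 0 < quotProd x n := by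
  induction n with
  | zero => exact one_pos
  | succ n ih => exact mul_pos ih (inv_pos.2 (one_pos.trans (hx _)))

theorem quotProd_strictAnti (hx : ∀ n, 1 < x n) : StrictAnti (quotProd x) :=
  strictAnti_nat_of_succ_lt fun n =>
    mul_lt_of_lt_one_right (quotProd_pos hx n) (inv_lt_one_of_one_lt₀ (hx _))

/-- The recurrence and monotonicity give B_n ≥ B_{n+1} + B_{n+2} ≥ 2B_{n+2}. -/
theorem exists_quotProd_lt (ha : ∀ n, 0 < a n) (hx1 : ∀ n, 1 < x n)
    (hx : ∀ n, x (n + 1) = (x n - a n)⁻¹) {v : ℝ} (hv : 0 < v) : ∃ n, quotProd x n < v := by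
  have half : ∀ n, 2 * quotProd x (n + 2) ≤ quotProd x n := by
    intro n
    have h1 := quotProd_recurrence hx (fun n => (one_pos.trans (hx1 n)).ne') n
    have h2 : (1 : ℝ) ≤ a (n + 1) := by exact_mod_cast ha (n + 1)
    have h3 := quotProd_strictAnti hx1 (Nat.lt_succ_self (n + 1))
    nlinarith [quotProd_pos hx1 (n + 1)]
  have iter : ∀ m, 2 ^ m * quotProd x (2 * m) ≤ 1 := by
    intro m
    induction m with
    | zero => simp [quotProd]
    | succ m ih =>
      have := half (2 * m)
      rw [pow_succ, show 2 * (m + 1) = 2 * m + 2 by ring]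
      nlinarith [pow_pos (two_pos : (0 : ℝ) < 2) m]
  obtain ⟨m, hm⟩ := pow_unbounded_of_one_lt (1 / v) (by norm_num : (1 : ℝ) < 2)
  refine ⟨2 * m, ?_⟩
  rw [div_lt_iff₀ hv] at hm
  have := iter m
  by_contra! h
  nlinarith [pow_pos (two_pos : (0 : ℝ) < 2) m]

/-- This detects parity: a product that is positive under ι₂ has even index. -/
theorem quotProd_sign (hy : ∀ n, -1 < y n ∧ y n < 0) (n : ℕ) :
    0 < (-1) ^ n * quotProd y n := by
  induction n with
  | zero => simp [quotProd]
  | succ n ih =>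
    have h1 : 0 < -(y (n + 1))⁻¹ := neg_pos.2 (inv_lt_zero.2 (hy _).2)
    have := mul_pos ih h1
    rw [quotProd, pow_succ]
    linarith

end Real

/-! ### Minimal vectors and totally positive units. -/

/-- A vector of the lattice `ℤ ω + ℤ` whose associated box contains no nonzero lattice vector is
one of the products of inverse complete quotients. -/
theorem exists_quotProd_eq_of_minimal {K : Type*} [Field K] (ι₁ ι₂ : K →+* ℝ) {a : ℕ → ℕ}
    {w : ℕ → K} (ha : ∀ n, 0 < a n) (hw : ∀ n, w (n + 1) = (w n - a n)⁻¹) (h0 : ∀ n, w n ≠ 0)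
    (hx : ∀ n, 1 < ι₁ (w n)) (hy : ∀ n, -1 < ι₂ (w n) ∧ ι₂ (w n) < 0) {v : K}
    (hv : ∃ p q : ℤ, v = p * w 0 + q) (hv0 : 0 < ι₁ v) (hv1 : ι₁ v < 1)
    (hmin : ∀ p q : ℤ, |ι₁ (p * w 0 + q)| < |ι₁ v| → |ι₂ (p * w 0 + q)| < |ι₂ v| →
      (p : K) * w 0 + q = 0) :
    ∃ n, 0 < n ∧ quotProd w n = v := by
  have hmap : ∀ (φ : K →+* ℝ) n, φ (quotProd w n) = quotProd (fun m => φ (w m)) n := by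
    intro φ n
    induction n with
    | zero => simp [quotProd]
    | succ n ih => simp [quotProd, ih]
  have hx' : ∀ n, ι₁ (w (n + 1)) = (ι₁ (w n) - a n)⁻¹ := fun n => by simp [hw]
  have hex := exists_quotProd_lt (x := fun n => ι₁ (w n)) ha hx hx' hv0
  classical
  -- The first product below v does not have index 0, since B₀ = 1 > v; hence B_{n+1} < v ≤ B_n.
  obtain ⟨n, hn⟩ : ∃ n, Nat.find hex = n + 1 := by
    refine Nat.exists_eq_succ_of_ne_zero fun h => ?_
    have := Nat.find_spec hex
    rw [h] at this
    simp only [quotProd] at this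
    linarith
  have hlo : ι₁ (quotProd w (n + 1)) < ι₁ v := by
    rw [hmap, ← hn]
    exact Nat.find_spec hex
  have hhi : ι₁ v ≤ ι₁ (quotProd w n) := by
    rw [hmap]
    exact not_lt.1 (Nat.find_min hex (by omega))
  have hB0 : 0 < ι₁ (quotProd w (n + 1)) := by
    rw [hmap]
    exact quotProd_pos hx _
  have hB1 : 0 < ι₁ (quotProd w n) := by
    rw [hmap]
    exact quotProd_pos hx _
  have hwB : w (n + 1) * quotProd w (n + 1) = quotProd w n := by
    rw [mul_comm, quotProd_mul h0]
  have hBne : quotProd w (n + 1) ≠ 0 := fun h => by simp [h] at hB0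
  -- Otherwise v = p'B_n + q'B_{n+1} lies strictly between the two, so p', q' have opposite signs,
  -- or p' = 0 and q' ≥ 2. As w_{n+1}' is negative, nothing cancels in p'w_{n+1}' + q', so B_{n+1}
  -- lies in the box of v, against minimality.
  have hkey : ι₁ v = ι₁ (quotProd w n) := by
    by_contra hne
    have hlt : ι₁ v < ι₁ (quotProd w n) := lt_of_le_of_ne hhi hne
    obtain ⟨p, q, hpq⟩ := hv
    obtain ⟨p', q', hpq'⟩ := exists_quotProd_basis hw h0 (n + 1) p q
    rw [← hpq, hwB] at hpq'
    have e1 : ι₁ v = p' * ι₁ (quotProd w n) + q' * ι₁ (quotProd w (n + 1)) := by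
      rw [hpq']
      simp
    have e2 : ι₂ v = (p' * ι₂ (w (n + 1)) + q') * ι₂ (quotProd w (n + 1)) := by
      rw [hpq', ← hwB]
      simp only [map_add, map_mul, map_intCast]
      ring
    have hB2 : 0 < |ι₂ (quotProd w (n + 1))| := abs_pos.2 ((map_ne_zero ι₂).2 hBne)
    obtain ⟨t1, t2⟩ := hy (n + 1)
    have hbig : 1 < |p' * ι₂ (w (n + 1)) + q'| := by
      rcases lt_trichotomy p' 0 with hp | hp | hp
      · have hp1 : (p' : ℝ) ≤ -1 := by exact_mod_cast Int.le_sub_one_of_lt hp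
        have hq : 0 < q' := by
          by_contra! hq
          have : (q' : ℝ) ≤ 0 := by exact_mod_cast hq
          nlinarith
        have hq1 : (1 : ℝ) ≤ q' := by exact_mod_cast hq
        exact lt_abs.2 (Or.inl (by nlinarith))
      · have hq : 1 < q' := by
          by_contra! hq
          have : (q' : ℝ) ≤ 1 := by exact_mod_cast hq
          rw [hp, Int.cast_zero, zero_mul, zero_add] at e1
          nlinarith
        have hq1 : (1 : ℝ) < q' := by exact_mod_cast hq
        exact lt_abs.2 (Or.inl (by rw [hp]; simpa using hq1))
      · have hp1 : (1 : ℝ) ≤ p' := by exact_mod_cast hp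
        have hq : q' < 0 := by
          by_contra! hq
          have : (0 : ℝ) ≤ q' := by exact_mod_cast hq
          nlinarith
        have hq1 : (q' : ℝ) ≤ -1 := by exact_mod_cast Int.le_sub_one_of_lt hq
        exact lt_abs.2 (Or.inr (by nlinarith))
    obtain ⟨s, t, hst⟩ := (quotProd_basis_mem hw h0 (n + 1)).2
    refine hBne (hst.trans (hmin s t ?_ ?_))
    · rw [← hst, abs_of_pos hB0, abs_of_pos hv0]
      exact hlo
    · rw [← hst, e2, abs_mul]
      exact lt_mul_of_one_lt_left hB2 hbig
  refine ⟨n, Nat.pos_of_ne_zero fun h => ?_, (ι₁.injective hkey).symm⟩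
  rw [h] at hkey
  simp only [quotProd, map_one] at hkey
  linarith

/-- The box of the vector `1` contains no nonzero vector of `ℤ ω + ℤ` if `ω > 1` and
`-1 < ω' < 0`. -/
theorem eq_zero_of_abs_lt_one {X Y : ℝ} (hX : 1 < X) (hY : -1 < Y ∧ Y < 0) {p q : ℤ}
    (h1 : |p * X + q| < 1) (h2 : |p * Y + q| < 1) : p = 0 ∧ q = 0 := by
  rw [abs_lt] at h1 h2
  have hp : p = 0 := by
    by_contra hp
    rcases lt_or_gt_of_ne hp with hp | hp
    · have hp1 : (p : ℝ) ≤ -1 := by exact_mod_cast Int.le_sub_one_of_lt hp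
      rcases le_or_gt q 0 with hq | hq
      · have hq1 : (q : ℝ) ≤ 0 := by exact_mod_cast hq
        nlinarith
      · have hq1 : (1 : ℝ) ≤ q := by exact_mod_cast hq
        nlinarith
    · have hp1 : (1 : ℝ) ≤ p := by exact_mod_cast hp
      rcases le_or_gt 0 q with hq | hq
      · have hq1 : (0 : ℝ) ≤ q := by exact_mod_cast hq
        nlinarith
      · have hq1 : (q : ℝ) ≤ -1 := by exact_mod_cast Int.le_sub_one_of_lt hq
        nlinarith
  subst hp
  simp only [Int.cast_zero, zero_mul, zero_add] at h1
  refine ⟨rfl, ?_⟩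
  have hq1 : -1 < q := by exact_mod_cast h1.1
  have hq2 : q < 1 := by exact_mod_cast h1.2
  omega

/-- Two reduced numbers that generate the same lattice together with `1` are equal. -/
theorem eq_of_same_lattice {X X' Y Y' : ℝ} {p q p' q' : ℤ} (hX : 1 < X) (hX' : 1 < X')
    (hY : -1 < Y ∧ Y < 0) (hY' : -1 < Y' ∧ Y' < 0) (h1 : X' = p * X + q) (h2 : Y' = p * Y + q)
    (h3 : X = p' * X' + q') (h4 : Y = p' * Y' + q') : X' = X := by
  -- Conjugate differences eliminate the shifts. Then p = -1 contradicts X > Y and X' > Y', and for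
  -- p = 1 the integer q is a difference of two numbers in (-1, 0).
  have hpp : p * p' = 1 := by
    have h5 : ((p * p' : ℤ) - 1 : ℝ) * (X - Y) = 0 := by
      push_cast
      linear_combination h4 - h3 - (p' : ℝ) * h1 + (p' : ℝ) * h2
    have h6 : X - Y ≠ 0 := by
      intro h
      linarith [hY.2]
    have h7 := (mul_eq_zero.1 h5).resolve_right h6
    have h8 : ((p * p' : ℤ) : ℝ) = 1 := by linarith
    exact_mod_cast h8
  rcases Int.isUnit_iff.1 (IsUnit.of_mul_eq_one _ hpp) with hp | hp
  · rw [hp, Int.cast_one, one_mul] at h1 h2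
    have hq1 : (-1 : ℝ) < q := by linarith [hY'.1, hY.2]
    have hq2 : (q : ℝ) < 1 := by linarith [hY'.2, hY.1]
    have hq3 : -1 < q := by exact_mod_cast hq1
    have hq4 : q < 1 := by exact_mod_cast hq2
    have hq : q = 0 := by omega
    rw [h1, hq]
    simp
  · rw [hp] at h1 h2
    push_cast at h1 h2
    linarith [hY.2, hY'.2]

/-- A totally positive unit `v < 1` of the multiplier ring of `ℤ ω + ℤ` is a product of inverse
complete quotients over an even period. -/
theorem exists_quotProd_eq_of_unit {K : Type*} [Field K] (ι₁ ι₂ : K →+* ℝ) {a : ℕ → ℕ}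
    {w : ℕ → K} (ha : ∀ n, 0 < a n) (hw : ∀ n, w (n + 1) = (w n - a n)⁻¹) (h0 : ∀ n, w n ≠ 0)
    (hx : ∀ n, 1 < ι₁ (w n)) (hy : ∀ n, -1 < ι₂ (w n) ∧ ι₂ (w n) < 0) {v ε : K}
    (hε : ε * v = 1) (hεΛ : ∀ p q : ℤ, ∃ p' q' : ℤ, ε * (p * w 0 + q) = p' * w 0 + q')
    (hvΛ : ∀ p q : ℤ, ∃ p' q' : ℤ, v * (p * w 0 + q) = p' * w 0 + q')
    (hv0 : 0 < ι₁ v) (hv1 : ι₁ v < 1) (hv2 : 0 < ι₂ v) :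
    ∃ n, 0 < n ∧ Even n ∧ quotProd w n = v ∧ w n = w 0 := by
  have hvne : v ≠ 0 := right_ne_zero_of_mul_eq_one hε
  have hεne : ε ≠ 0 := left_ne_zero_of_mul_eq_one hε
  -- Multiplication by ε carries the box of v to the box of 1, which contains no nonzero lattice
  -- vector.
  have hsmall : ∀ (φ : K →+* ℝ) (u : K), |φ u| < |φ v| → |φ (ε * u)| < 1 := by
    intro φ u hu
    have h1 : |φ ε| * |φ v| = 1 := by rw [← abs_mul, ← map_mul, hε, map_one, abs_one]
    rw [map_mul, abs_mul, ← h1]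
    exact mul_lt_mul_of_pos_left hu (abs_pos.2 ((map_ne_zero φ).2 hεne))
  obtain ⟨n, hn0, hn⟩ := exists_quotProd_eq_of_minimal ι₁ ι₂ ha hw h0 hx hy
    (v := v) (by simpa using hvΛ 0 1) hv0 hv1 (by
      intro p q h1 h2
      obtain ⟨p', q', h3⟩ := hεΛ p q
      have h4 := hsmall ι₁ _ h1
      have h5 := hsmall ι₂ _ h2
      rw [h3] at h4 h5
      simp only [map_add, map_mul, map_intCast] at h4 h5
      obtain ⟨h6, h7⟩ := eq_zero_of_abs_lt_one (hx 0) (hy 0) h4 h5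
      rw [h6, h7, Int.cast_zero, zero_mul, zero_add] at h3
      exact (mul_eq_zero.1 h3).resolve_left hεne)
  have hmap : ∀ n, ι₂ (quotProd w n) = quotProd (fun m => ι₂ (w m)) n := by
    intro n
    induction n with
    | zero => simp [quotProd]
    | succ n ih => simp [quotProd, ih]
  have heven : Even n := by
    by_contra ho
    have h1 := quotProd_sign hy n
    rw [(Nat.not_even_iff_odd.1 ho).neg_one_pow, ← hmap, hn] at h1
    linarith
  refine ⟨n, hn0, heven, hn, ι₁.injective ?_⟩
  -- Multiplying by v maps ℤw₀ + ℤ to itself and B_n = v, so (w_n, 1) and (w₀, 1) span the same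
  -- lattice; both numbers are reduced, hence equal.
  obtain ⟨⟨p, q, h1⟩, -⟩ := quotProd_basis_mem hw h0 n
  obtain ⟨p', q', h2⟩ := hεΛ p q
  rw [← h1, hn, mul_comm (w n), ← mul_assoc, hε, one_mul] at h2
  obtain ⟨s, t, h3⟩ := hvΛ 1 0
  obtain ⟨s', t', h4⟩ := exists_quotProd_basis hw h0 n s t
  rw [← h3, hn] at h4
  have h5 : w 0 = s' * w n + t' := by
    refine mul_left_cancel₀ hvne ?_
    rw [Int.cast_one, one_mul, Int.cast_zero, add_zero] at h4
    rw [h4]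
    ring
  exact eq_of_same_lattice (hx 0) (hx n) (hy 0) (hy n) (by simpa using congrArg ι₁ h2)
    (by simpa using congrArg ι₂ h2) (by simpa using congrArg ι₁ h5) (by simpa using congrArg ι₂ h5)

/-! ### The lattice 𝔟⁻¹. -/

section Lattice

variable {K : Type*} [Field K] [NumberField K] {b : Ideal (NumberField.RingOfIntegers K)} {ω : K}

/-- By convention the zero fractional ideal has inverse zero, while the lattice contains 1. -/
theorem ideal_ne_bot_of_inv_lattice
    (hb : ∀ x : K, x ∈ ((b : FractionalIdeal (NumberField.RingOfIntegers K)⁰ K))⁻¹ ↔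
      ∃ m n : ℤ, x = (m : K) * ω + (n : K)) : b ≠ ⊥ := by
  rintro rfl
  have h := (hb 1).2 ⟨0, 1, by simp⟩
  rw [FractionalIdeal.coeIdeal_bot, inv_zero, FractionalIdeal.mem_zero_iff] at h
  exact one_ne_zero h

theorem unit_mul_mem_inv_lattice
    (hb : ∀ x : K, x ∈ ((b : FractionalIdeal (NumberField.RingOfIntegers K)⁰ K))⁻¹ ↔
      ∃ m n : ℤ, x = (m : K) * ω + (n : K)) (η : NumberField.RingOfIntegers K) (p q : ℤ) :
    ∃ p' q' : ℤ, (η : K) * (p * ω + q) = p' * ω + q' := by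
  rw [← hb]
  have h := (hb (p * ω + q)).2 ⟨p, q, rfl⟩
  have := Submodule.smul_mem
    (((b : FractionalIdeal (NumberField.RingOfIntegers K)⁰ K)⁻¹ :
      FractionalIdeal (NumberField.RingOfIntegers K)⁰ K) :
      Submodule (NumberField.RingOfIntegers K) K) η h
  rwa [Algebra.smul_def] at this

theorem integer_mem_inv_lattice
    (hb : ∀ x : K, x ∈ ((b : FractionalIdeal (NumberField.RingOfIntegers K)⁰ K))⁻¹ ↔
      ∃ m n : ℤ, x = (m : K) * ω + (n : K)) (η : NumberField.RingOfIntegers K) :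
    ∃ p q : ℤ, (η : K) = p * ω + q := by
  obtain ⟨p, q, h⟩ := unit_mul_mem_inv_lattice hb η 0 1
  exact ⟨p, q, by simpa using h⟩

/-- Since 1 lies in the lattice, so does every integer of K; equal images of ω would make the
embeddings agree on integers, hence on fractions. -/
theorem embeddings_ne_of_inv_lattice
    (hb : ∀ x : K, x ∈ ((b : FractionalIdeal (NumberField.RingOfIntegers K)⁰ K))⁻¹ ↔
      ∃ m n : ℤ, x = (m : K) * ω + (n : K)) {ι₁ ι₂ : K →+* ℝ} (hι : ι₁ ≠ ι₂) :
    ι₁ ω ≠ ι₂ ω := by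
  intro h
  have hint : ∀ η : NumberField.RingOfIntegers K, ι₁ η = ι₂ η := by
    intro η
    obtain ⟨p, q, hpq⟩ := integer_mem_inv_lattice hb η
    rw [hpq]
    simp [h]
  refine hι (RingHom.ext fun x => ?_)
  obtain ⟨s, t, -, rfl⟩ := IsFractionRing.div_surjective (NumberField.RingOfIntegers K) x
  rw [map_div₀, map_div₀]
  exact congrArg₂ _ (hint s) (hint t)

end Lattice

/-! ### Identification of the fundamental unit. -/

/-- The totally positive fundamental unit is `α ω + β`: its minimal polynomial and its action on
the lattice. -/
theorem fundamental_unit_eq {K : Type*} [Field K] [NumberField K]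
    (ι₁ ι₂ : K →+* ℝ) (hι : ι₁ ≠ ι₂)
    (b : Ideal (NumberField.RingOfIntegers K)) (ω : K)
    (hb : ∀ x : K, x ∈ ((b : FractionalIdeal (NumberField.RingOfIntegers K)⁰ K))⁻¹ ↔
      ∃ m n : ℤ, x = (m : K) * ω + (n : K))
    (a : ℕ → ℕ) (r : ℕ) (hω : IsPurelyPeriodicCF (ι₁ ω) a r)
    (ε : (NumberField.RingOfIntegers K)ˣ) (hε : IsTotPosFundamentalUnit ι₁ ι₂ ε)
    (l : ℕ) (hl : l = evenPeriod r)
    (α β : ℤ) (hα : α = (cfVec a l (l + 1)).1) (hβ : β = (cfVec a l (l + 1)).2)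
    (γ δ : ℤ) (hγ : γ = (cfVec a l l).1) (hδ : δ = (cfVec a l l).2) :
    ((ε : NumberField.RingOfIntegers K) : K) = α * ω + β ∧ 0 < α ∧ 0 < (a 0 : ℤ) * α + β + γ ∧
      ι₁ (ε : NumberField.RingOfIntegers K) + ι₂ (ε : NumberField.RingOfIntegers K)
        = (a 0 : ℝ) * α + β + γ ∧
      ι₁ (ε : NumberField.RingOfIntegers K) * ι₂ (ε : NumberField.RingOfIntegers K) = 1 := by
  obtain ⟨⟨hh, hd⟩, ha, hr, hper, hmin⟩ := hω
  obtain ⟨hε1, hε2, hgen⟩ := hε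
  have hl_even : Even l := hl ▸ even_evenPeriod r
  have hrl : r ∣ l := by
    rw [hl, evenPeriod]
    split_ifs
    · exact dvd_rfl
    · exact dvd_mul_left r 2
  have hl0 : 0 < l := by
    rw [hl, evenPeriod]
    split_ifs <;> omega
  have hl2 : 2 ≤ l := by
    obtain ⟨m, hm⟩ := hl_even
    omega
  have hperk : ∀ k m, a (m + r * k) = a m := by
    intro k
    induction k with
    | zero => intro m; rfl
    | succ k ih => intro m; rw [mul_add, mul_one, ← add_assoc, hper, ih]
  have hperl : ∀ m, a (m + l) = a m := by
    obtain ⟨k, hk⟩ := hrl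
    rw [hk]
    exact hperk k
  have hal : a l = a 0 := by simpa using hperl 0
  set w : ℕ → K := completeQuot a ω with hwdef
  have hw0 : w 0 = ω := rfl
  have hw : ∀ n, w (n + 1) = (w n - a n)⁻¹ := fun _ => rfl
  have hx : ∀ n, (a n : ℝ) < ι₁ (w n) ∧ ι₁ (w n) < a n + 1 := fun n => by
    rw [hwdef, map_completeQuot]
    exact completeQuot_mem_Ioo hh hd n
  have hx1 : ∀ n, 1 < ι₁ (w n) := fun n =>
    lt_of_le_of_lt (by exact_mod_cast ha n) (hx n).1
  have hxs : ∀ n, ι₁ (w (n + 1)) = (ι₁ (w n) - a n)⁻¹ := fun n => by simp [hw]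
  have hys : ∀ n, ι₂ (w (n + 1)) = (ι₂ (w n) - a n)⁻¹ := fun n => by simp [hw]
  have h0 : ∀ n, w n ≠ 0 := fun n h => by
    have := hx1 n
    rw [h, map_zero] at this
    linarith
  have hwper : ∀ k, (∀ m, a (m + k) = a m) → ∀ n, w (n + k) = w n := by
    intro k hk n
    -- Shifting by a period of the partial quotients preserves all integer parts, and these
    -- determine the complete quotients.
    refine ι₁.injective ?_
    have := eq_of_same_partial_quotients ha (x := fun n => ι₁ (w (n + k)))
      (y := fun n => ι₁ (w n)) (fun n => by simpa only [hk] using hx (n + k)) hx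
      (fun n => by
        have := hxs (n + k)
        rw [hk] at this
        rw [← this]
        congr 2
        omega) hxs
    exact congrFun this n
  have hωne := embeddings_ne_of_inv_lattice hb hι
  have hy : ∀ n, -1 < ι₂ (w n) ∧ ι₂ (w n) < 0 :=
    conj_completeQuot_mem_Ioo ha hr hx hxs hys
      (fun n => by rw [hwper r hper]) (fun h => hωne (congrFun h 0))
      (fun n => (map_ne_zero ι₂).2 (h0 n))
  have hwl : w l = w 0 := by simpa using hwper l hperl 0
  -- the vectors attached to the continued fraction
  obtain ⟨hV0, hV1⟩ := cfVec_mul_quotProd hw h0 hal hwl l le_rfl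
  rw [← hγ, ← hδ, hw0, show l + 1 - l = 1 by omega, quotProd_succ hw 0] at hV0
  rw [← hα, ← hβ, hw0, Nat.sub_self] at hV1
  simp only [quotProd, one_mul, hw0] at hV0 hV1
  have hdet : γ * β - α * δ = 1 := by
    have := cfVec_det a l l
    rw [← hα, ← hβ, ← hγ, ← hδ, hl_even.neg_one_pow] at this
    exact this
  obtain ⟨m, hm⟩ : ∃ m, l = m + 2 := ⟨l - 2, by omega⟩
  have hα0 : 0 < α := by
    rw [hα, show l + 1 = (m + 1) + 2 by omega]
    exact cfVec_fst_pos hal ha _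
  have hβ0 : 0 ≤ β := by
    rw [hβ]
    exact (cfVec_nonneg hal l).2.1
  have hγ0 : 0 < γ := by
    have h1 := cfVec_fst_pos hal ha m
    rw [← hm] at h1
    rw [hγ]
    exact h1
  have ha0 : (0 : ℤ) < a 0 := by exact_mod_cast ha 0
  have hT0 : 0 < (a 0 : ℤ) * α + β + γ := by positivity
  set e : K := α * ω + β with he
  -- With e = αω + β, this is the second row of multiplication by e in the basis (1, ω). The trace
  -- is T and the determinant γβ - αδ = 1, whence e(T - e) = 1.
  have heω : e * ω = a 0 * e + (γ * ω + δ) := by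
    linear_combination (γ * ω + δ) * hV1 - e * hV0
  set T : ℤ := (a 0 : ℤ) * α + β + γ with hT
  have hdetK : (γ : K) * β - α * δ = 1 := by exact_mod_cast hdet
  have hee : e * (T - e) = 1 := by
    rw [hT]
    push_cast
    linear_combination hdetK - (α : K) * heω + (γ + (a 0 : K) * α - e) * he
  have hint : IsIntegral ℤ e := by
    refine ⟨Polynomial.X ^ 2 - Polynomial.C T * Polynomial.X + 1, ?_, ?_⟩
    · monicity!
    · simp only [Polynomial.eval₂_add, Polynomial.eval₂_sub, Polynomial.eval₂_mul,
        Polynomial.eval₂_pow, Polynomial.eval₂_X, Polynomial.eval₂_C, Polynomial.eval₂_one]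
      rw [show (algebraMap ℤ K) T = (T : K) from rfl]
      linear_combination -hee
  let e₀ : NumberField.RingOfIntegers K := ⟨e, hint⟩
  have he₀ : (e₀ : K) = e := rfl
  have hee₀ : e₀ * (T - e₀) = 1 := by
    apply NumberField.RingOfIntegers.coe_injective
    simpa [he₀] using hee
  let u : (NumberField.RingOfIntegers K)ˣ := Units.mkOfMulEqOne e₀ (T - e₀) hee₀
  have hu : ((u : NumberField.RingOfIntegers K) : K) = e := rfl
  have hT0' : (0 : ℝ) < T := by exact_mod_cast hT0
  have heR : ∀ φ : K →+* ℝ, φ e * (T - φ e) = 1 := fun φ => by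
    simpa using congrArg φ hee
  have hepos : ∀ φ : K →+* ℝ, 0 < φ e := by
    intro φ
    have := heR φ
    by_contra! h
    nlinarith
  have hα1 : (1 : ℝ) ≤ α := by exact_mod_cast hα0
  have hβ1 : (0 : ℝ) ≤ β := by exact_mod_cast hβ0
  have he1 : 1 < ι₁ e := by
    have h1 : ι₁ e = α * ι₁ ω + β := by simp [he]
    have h2 := hx1 0
    rw [hw0] at h2
    rw [h1]
    nlinarith
  -- the fundamental unit is a product of inverse complete quotients
  set ε' : K := ((ε : NumberField.RingOfIntegers K) : K) with hε'
  set v : K :=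
    (((ε⁻¹ : (NumberField.RingOfIntegers K)ˣ) : NumberField.RingOfIntegers K) : K) with hv
  have hεv : ε' * v = 1 := by
    rw [hε', hv, ← map_mul, ← Units.val_mul, mul_inv_cancel]
    simp
  have hεv1 : ι₁ ε' * ι₁ v = 1 := by rw [← map_mul, hεv, map_one]
  have hεv2 : ι₂ ε' * ι₂ v = 1 := by rw [← map_mul, hεv, map_one]
  have hv1 : 0 < ι₁ v := pos_of_mul_pos_right (hεv1 ▸ one_pos) (by linarith : 0 ≤ ι₁ ε')
  have hv2 : 0 < ι₂ v := pos_of_mul_pos_right (hεv2 ▸ one_pos) hε2.le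
  obtain ⟨n, hn0, hneven, hnv, hnw⟩ := exists_quotProd_eq_of_unit ι₁ ι₂ ha hw h0 hx1 hy hεv
    (unit_mul_mem_inv_lattice hb _) (unit_mul_mem_inv_lattice hb _) hv1 (by nlinarith) hv2
  -- From w_n = w₀ the partial quotients, being integer parts, have period n, so ℓ divides the even
  -- number n.
  have hwn : ∀ m, w (m + n) = w m ∧ a (m + n) = a m := by
    have hfl : ∀ i j, w i = w j → a i = a j := by
      intro i j hij
      have h1 := hx i
      have h2 := hx j
      rw [hij] at h1
      have h3 : (a i : ℝ) < a j + 1 := h1.1.trans h2.2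
      have h4 : (a j : ℝ) < a i + 1 := h2.1.trans h1.2
      have h5 : a i < a j + 1 := by exact_mod_cast h3
      have h6 : a j < a i + 1 := by exact_mod_cast h4
      omega
    intro m
    induction m with
    | zero => rw [zero_add]; exact ⟨hnw, hfl _ _ hnw⟩
    | succ m ih =>
      have : w (m + 1 + n) = w (m + 1) := by
        rw [show m + 1 + n = m + n + 1 by omega, hw, hw, ih.1, ih.2]
      exact ⟨this, hfl _ _ this⟩
  have hln : l ≤ n := by
    rw [hl]
    exact Nat.le_of_dvd hn0
      (evenPeriod_dvd hneven (minimal_period_dvd hr hper hmin fun m => (hwn m).2))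
  have hmap : ∀ n, ι₁ (quotProd w n) = quotProd (fun m => ι₁ (w m)) n := by
    intro n
    induction n with
    | zero => simp [quotProd]
    | succ n ih => simp [quotProd, ih]
  have hle : ι₁ e ≤ ι₁ ε' := by
    have h1 : ι₁ v ≤ ι₁ (quotProd w l) := by
      rw [← hnv, hmap, hmap]
      exact (quotProd_strictAnti hx1).antitone hln
    have h2 : ι₁ e * ι₁ (quotProd w l) = 1 := by rw [← map_mul, hV1, map_one]
    nlinarith [hepos ι₁]
  obtain ⟨N, hN⟩ := hgen u (hepos ι₁) (hepos ι₂)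
  have hNe : ι₁ e = ι₁ ε' ^ N := by
    rw [← hu, hN]
    have h := map_zpow (Units.map ((ι₁.comp (algebraMap (NumberField.RingOfIntegers K) K)
      : NumberField.RingOfIntegers K →+* ℝ) : NumberField.RingOfIntegers K →* ℝ)) ε N
    have h' := congrArg (Units.val) h
    rw [Units.val_zpow_eq_zpow_val] at h'
    exact h'
  have hN1 : 1 ≤ N := by
    by_contra! h
    have : ι₁ ε' ^ N ≤ ι₁ ε' ^ (0 : ℤ) := zpow_le_zpow_right₀ hε1.le (by omega)
    rw [zpow_zero, ← hNe] at this
    linarith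
  -- Being totally positive and greater than 1, e is a positive power of ε; together with e ≤ ε this
  -- forces equality.
  have hge : ι₁ ε' ≤ ι₁ e := by
    rw [hNe]
    calc ι₁ ε' = ι₁ ε' ^ (1 : ℤ) := (zpow_one _).symm
      _ ≤ _ := zpow_le_zpow_right₀ hε1.le hN1
  have hεe : ε' = e := ι₁.injective (le_antisymm hge hle)
  -- Both conjugates solve t(T - t) = 1, and they differ because α ≠ 0 and ω ≠ ω'.
  have hsum : ι₁ e + ι₂ e = T := by
    have h1 : (ι₁ e - ι₂ e) * (ι₁ e + ι₂ e - T) = 0 := by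
      linear_combination heR ι₂ - heR ι₁
    refine sub_eq_zero.1 ((mul_eq_zero.1 h1).resolve_left fun h2 => ?_)
    have h3 : (α : ℝ) * (ι₁ ω - ι₂ ω) = 0 := by
      rw [← h2, he]
      simp
      ring
    rcases mul_eq_zero.1 h3 with h4 | h4
    · linarith
    · exact hωne (sub_eq_zero.1 h4)
  refine ⟨hεe, hα0, hT0, ?_, ?_⟩
  · rw [hεe, hsum, hT]
    push_cast
    ring
  · rw [hεe]
    have := heR ι₁
    rw [← hsum] at this
    linarith

/-! ### Assembly. -/

theorem mainTheorem5 {K : Type*} [Field K] [NumberField K]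
    (hK : Module.finrank ℚ K = 2)
    (ι₁ ι₂ : K →+* ℝ) (hι : ι₁ ≠ ι₂)
    (b : Ideal (NumberField.RingOfIntegers K)) (ω : K)
    (hb : ∀ x : K,
      x ∈ ((b : FractionalIdeal (NumberField.RingOfIntegers K)⁰ K))⁻¹ ↔
        ∃ m n : ℤ, x = (m : K) * ω + (n : K))
    (a : ℕ → ℕ) (r : ℕ) (hω : IsPurelyPeriodicCF (ι₁ ω) a r)
    (ε : (NumberField.RingOfIntegers K)ˣ) (hε : IsTotPosFundamentalUnit ι₁ ι₂ ε)
    (l : ℕ) (hl : l = evenPeriod r)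
    (α β : ℤ) (hα : α = cfAlpha a l (l - 1)) (hβ : β = cfBeta a l (l - 1))
    (γ : ℤ) (hγ : γ = cfAlpha a l (l - 2))
    (P : ℝ × ℝ → ℝ)
    (hP : P = traceForm (Ideal.absNorm b) α
      (ι₁ (ε : NumberField.RingOfIntegers K) + ι₂ (ε : NumberField.RingOfIntegers K)))
    (k : ℕ) :
    -- the integral converges and is a smooth function of `h`
    ((∀ h : ℝ × ℝ, MeasureTheory.IntegrableOn
        (fun x => Real.exp (-normForm ι₁ ι₂ b ω x)) (shiftedCone α β h)) ∧
      ContDiff ℝ ((⊤ : ℕ∞) : WithTop ℕ∞) (coneIntegral (normForm ι₁ ι₂ b ω) α β)) ∧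
    -- the boundary operator annihilates it at `h = 0`
    diffOp (boundarySymbol a l k) (coneIntegral (normForm ι₁ ι₂ b ω) α β) (0, 0) = 0 ∧
    -- the trace of the totally positive fundamental unit
    ι₁ (ε : NumberField.RingOfIntegers K) + ι₂ (ε : NumberField.RingOfIntegers K) =
      (a 0 : ℝ) * α + β + γ ∧
    -- evaluation of the boundary expression through `P`
    (MeasureTheory.IntegrableOn
        (fun x₂ : ℝ => iteratedDeriv (2 * k + 1) (fun x₁ : ℝ => Real.exp (-P (-x₁, x₂))) 0)
        (Set.Ioi 0) ∧
      diffOp (boundaryPoly a l k) (coneIntegral (normForm ι₁ ι₂ b ω) α β) (0, 0) =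
        1 / (α : ℝ) * ∑ i ∈ Finset.range (2 * k + 1),
          (-1 : ℝ) ^ (i + 1) * ((2 * k + 1).choose (i + 1) : ℝ) *
            (((a 0 : ℝ) * α + β) ^ (i + 1) + (γ : ℝ) ^ (i + 1)) *
            (partialTwo^[i] (partialOne^[2 * k - i] (fun h => Real.exp (-P h)))) (0, 0)
        + 2 / (α : ℝ) * ∫ x₂ in Set.Ioi (0 : ℝ),
            iteratedDeriv (2 * k + 1) (fun x₁ : ℝ => Real.exp (-P (-x₁, x₂))) 0) := by

  have hl1 : ((l : ℤ) - 1 + 2).toNat = l + 1 := by omega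
  have hl2 : ((l : ℤ) - 2 + 2).toNat = l := by omega
  obtain ⟨hεω, hα0, hT0, htrace, hnorm⟩ := fundamental_unit_eq ι₁ ι₂ hι b ω hb a r hω ε hε l hl
    α β (by rw [hα, cfAlpha, hl1]) (by rw [hβ, cfBeta, hl1]) γ _ (by rw [hγ, cfAlpha, hl2]) rfl
  have hdet : γ * β - α * cfBeta a l (l - 2) = 1 := by
    have h1 := cfVec_det a l l
    have heven : Even l := hl ▸ even_evenPeriod r
    rw [heven.neg_one_pow] at h1
    rw [hγ, hβ, hα, cfAlpha, cfAlpha, cfBeta, cfBeta, hl1, hl2]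
    exact h1
  have hal : a l = a 0 := by
    obtain ⟨-, -, -, hper, -⟩ := hω
    rw [hl, evenPeriod]
    split_ifs
    · simpa using hper 0
    · rw [two_mul, hper]
      simpa using hper 0
  have hα' : (0 : ℝ) < α := by exact_mod_cast hα0
  set T : ℝ := ι₁ (ε : NumberField.RingOfIntegers K) + ι₂ (ε : NumberField.RingOfIntegers K)
    with hTdef
  have hT : 0 ≤ T := by
    rw [htrace]
    exact_mod_cast hT0.le
  have hN : (0 : ℝ) < Ideal.absNorm b := by
    have h1 : Ideal.absNorm b ≠ 0 := fun h =>
      ideal_ne_bot_of_inv_lattice hb (Ideal.absNorm_eq_zero_iff.1 h)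
    exact_mod_cast Nat.pos_of_ne_zero h1
  set c : ℝ := (Ideal.absNorm b : ℝ) / (α : ℝ) ^ 2 with hc
  have hc0 : 0 < c := by positivity
  -- Here α(x₁ω + x₂) = (-βx₁ + αx₂) + εx₁, likewise for the conjugate; εε' = 1 gives the
  -- coefficient of x₁².
  have hQ : ∀ x : ℝ × ℝ, normForm ι₁ ι₂ b ω x = c * (x.1 ^ 2
      + T * (x.1 * -β + x.2 * α) * x.1 + (x.1 * -β + x.2 * α) ^ 2) := by
    intro x
    have h1 : ι₁ (ε : NumberField.RingOfIntegers K) = α * ι₁ ω + β := by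
      rw [hεω]
      simp
    have h2 : ι₂ (ε : NumberField.RingOfIntegers K) = α * ι₂ ω + β := by
      rw [hεω]
      simp
    rw [h1, h2] at hnorm hTdef
    rw [normForm, hc, hTdef]
    field_simp
    linear_combination x.1 ^ 2 * hnorm
  have hcone := coneIntegral_eq_quadrantIntegral hα0 hc0 hT hQ
  have hI : coneIntegral (normForm ι₁ ι₂ b ω) α β
      = fun h => 1 / (α : ℝ) * quadrantIntegral c T h := funext fun h => (hcone h).2
  have hpoly := boundaryPoly_eq a l k (hl ▸ even_evenPeriod r) hal hα hβ hγ hdet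
  obtain ⟨hint, heval⟩ := diffOp_boundary_quadrantIntegral_eq hc0 hT ((a 0 : ℝ) * α + β) γ k
    (P := P) (fun x => by rw [hP]; rfl)
  refine ⟨⟨fun h => (hcone h).1, ?_⟩, ?_, htrace, hint, ?_⟩
  · rw [hI]
    exact contDiff_const.mul (contDiff_quadrantIntegral hc0 hT)
  · rw [hI, diffOp_const_mul, boundarySymbol, diffOp_C_mul, hpoly,
      diffOp_boundary_quadrantIntegral hc0 hT htrace, mul_zero, mul_zero]
  · rw [hI, diffOp_const_mul, hpoly, heval]
    ring
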